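/- Let $K$ be a compact Lie group, realized as a closed subgroup of the orthogonal group $O(n)$, with Lie algebra $\mathfrak k\subseteq M_n(\mathbb R)$ equipped with an $\mathrm{Ad}$-invariant inner product, where $\mathrm{Ad}_kX=kXk^{-1}$. Let $\mathbb I=[0,1]$ with Lebesgue measure. For a step function $f\colon\mathbb I\to\mathfrak k$ with constant value $f_i$ on $[t_i,t_{i+1})$, $0=t_0<t_1<\dots<t_m=1$, the product integral is $$\prod_0^t\exp f(s)\,ds=\exp((t-t_j)f_j)\,\exp((t_j-t_{j-1})f_{j-1})\cdots\exp(t_1f_0)\in K,\qquad t\in[t_j,t_{j+1}],$$ and it is extended by continuity to all $f\in L^2(\mathbb I,\mathfrak k)$. Equip $L^2(\mathbb I,\mathfrak k)$ with the group law $f\ast g=f+\mathrm{Ad}_{\Pi\exp f}\,g$, where $\Pi\exp f$ is the function $t\mapsto\prod_0^t\exp f(s)\,ds$ and $\mathrm{Ad}$ is applied pointwise. For $N\ge 1$ let $V_N\subseteq L^2(\mathbb I,\mathfrak k)$ be the finite-dimensional Euclidean space of all functions that are a.e. constant on each of the intervals $[i/N,(i+1)/N)$, $0\le i<N$, and for $R>0$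 let $\nu_{N,R}$ be the uniform probability measure (normalized Lebesgue measure) on the ball of radius $R$ centred at zero in $V_N$, regarded as a Borel probability measure on $L^2(\mathbb I,\mathfrak k)$. For a Borel measure $\mu$ on $L^2(\mathbb I,\mathfrak k)$ and $g\in L^2(\mathbb I,\mathfrak k)$ let $\mu\ast g$ be the image of $\mu$ under $f\mapsto f\ast g$. Let $(R_N)_{N\ge1}$ be a sequence of positive reals with $\sqrt N=o(R_N)$ and $R_N=o(N)$ as $N\to\infty$, and let $g\in V_\infty=\bigcup_{m\ge1}V_m$. Then, as $N\to\infty$, the Monge–Kantorovich distance between $\nu_{N,R_N}$ and $\nu_{N,R_N}\ast g$, that is, the infimum of $\int\min(\|x-y\|_2,1)\,d\pi(x,y)$ over all couplings $\pi$ of the two measures, tends to $0$. Equivalently, $$\int F\,d\nu_{N,R_N}-\int F\,d(\nu_{N,R_N}\ast g)\longrightarrow 0\quad\text{as }N\to\infty$$ uniformly over all functions $F\colon L^2(\mathbb I,\mathfrak k)\to\mathbb R$ that are $1$-Lipschitz for the norm and satisfy $\|F\|_\infty\le1$. -/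

import Mathlib

open MeasureTheory Filter Topology
open scoped ENNReal

noncomputable section

namespace PathGroup

/-! ### The Lie algebra of a closed group of orthogonal matrices -/

/-- In a Banach algebra, `(exp (X/m) exp (Y/m)) ^ m → exp (X + Y)`. -/
theorem tendsto_exp_mul_exp_pow {A : Type*} [NormedRing A] [NormedAlgebra ℝ A] [NormOneClass A]
    [CompleteSpace A] (X Y : A) :
    Tendsto (fun m : ℕ => (NormedSpace.exp ((1 / ((m : ℝ) + 1)) • X) *
      NormedSpace.exp ((1 / ((m : ℝ) + 1)) • Y)) ^ (m + 1)) atTop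
      (𝓝 (NormedSpace.exp (X + Y))) := by
  let : NormedAlgebra ℚ A := NormedAlgebra.restrictScalars ℚ ℝ A
  -- the norm of an exponential
  have hexp : ∀ Z : A, ‖NormedSpace.exp Z‖ ≤ Real.exp ‖Z‖ := by
    intro Z
    rw [NormedSpace.exp_eq_tsum ℝ, Real.exp_eq_exp_ℝ, NormedSpace.exp_eq_tsum ℝ]
    refine tsum_of_norm_bounded (NormedSpace.expSeries_summable' (𝕂 := ℝ) ‖Z‖).hasSum ?_
    intro k
    rw [norm_smul, smul_eq_mul, Real.norm_of_nonneg (by positivity)]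
    gcongr
    exact norm_pow_le Z k
  -- powers of nearby elements
  have hpow : ∀ (a b : A) (c : ℝ), 1 ≤ c → ‖a‖ ≤ c → ‖b‖ ≤ c → ∀ m : ℕ,
      ‖a ^ m - b ^ m‖ ≤ m * c ^ m * ‖a - b‖ := by
    intro a b c hc ha hb m
    induction m with
    | zero => simp
    | succ m ih =>
      have e : a ^ (m + 1) - b ^ (m + 1) = a ^ m * (a - b) + (a ^ m - b ^ m) * b := by
        rw [pow_succ, pow_succ]; noncomm_ring
      have h1 : ‖a ^ m * (a - b)‖ ≤ c ^ (m + 1) * ‖a - b‖ := by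
        refine (norm_mul_le _ _).trans ?_
        gcongr
        calc ‖a ^ m‖ ≤ ‖a‖ ^ m := norm_pow_le _ _
          _ ≤ c ^ m := by gcongr
          _ ≤ c ^ (m + 1) := pow_le_pow_right₀ hc (Nat.le_succ m)
      have h2 : ‖(a ^ m - b ^ m) * b‖ ≤ (m * c ^ m * ‖a - b‖) * c := by
        refine (norm_mul_le _ _).trans ?_
        gcongr
      rw [e]
      refine (norm_add_le _ _).trans ((add_le_add h1 h2).trans (le_of_eq ?_))
      push_cast; ring
  -- the curves agree to first order
  have hd : HasDerivAt (fun t : ℝ => NormedSpace.exp (t • X) * NormedSpace.exp (t • Y)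
      - NormedSpace.exp (t • (X + Y))) 0 0 := by
    have h1 := hasDerivAt_exp_smul_const (𝕂 := ℝ) X (0 : ℝ)
    have h2 := hasDerivAt_exp_smul_const (𝕂 := ℝ) Y (0 : ℝ)
    have h3 := hasDerivAt_exp_smul_const (𝕂 := ℝ) (X + Y) (0 : ℝ)
    have := (h1.mul h2).sub h3
    simp only [zero_smul, NormedSpace.exp_zero, one_mul, mul_one, sub_self] at this
    exact this
  have hs : Tendsto (fun m : ℕ => (1 / ((m : ℝ) + 1))) atTop (𝓝[≠] 0) := by
    refine tendsto_nhdsWithin_iff.2 ⟨tendsto_one_div_add_atTop_nhds_zero_nat, ?_⟩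
    exact Eventually.of_forall fun m => (by positivity : (1 / ((m : ℝ) + 1)) ≠ 0)
  have hslope := (hasDerivAt_iff_tendsto_slope.1 hd).comp hs
  rw [tendsto_iff_norm_sub_tendsto_zero]
  refine squeeze_zero (fun _ => norm_nonneg _) (g := fun m : ℕ => Real.exp (‖X‖ + ‖Y‖) *
    ‖slope (fun t : ℝ => NormedSpace.exp (t • X) * NormedSpace.exp (t • Y)
      - NormedSpace.exp (t • (X + Y))) 0 (1 / ((m : ℝ) + 1))‖) ?_ ?_
  · intro m
    have hm : (0 : ℝ) < (m : ℝ) + 1 := by positivity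
    set s : ℝ := 1 / ((m : ℝ) + 1) with hsdef
    have hs0 : 0 < s := by positivity
    have hb : NormedSpace.exp (X + Y) = NormedSpace.exp (s • (X + Y)) ^ (m + 1) := by
      rw [← NormedSpace.exp_nsmul, ← Nat.cast_smul_eq_nsmul ℝ, smul_smul]
      have : ((m + 1 : ℕ) : ℝ) * s = 1 := by rw [hsdef]; push_cast; field_simp
      rw [this, one_smul]
    have hc := hpow (NormedSpace.exp (s • X) * NormedSpace.exp (s • Y))
      (NormedSpace.exp (s • (X + Y))) (Real.exp (s * (‖X‖ + ‖Y‖)))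
      (Real.one_le_exp (by positivity)) ?_ ?_ (m + 1)
    · rw [hb]
      refine hc.trans (le_of_eq ?_)
      rw [slope_def_module, ← Real.exp_nat_mul, ← mul_assoc]
      have : ((m + 1 : ℕ) : ℝ) * s = 1 := by rw [hsdef]; push_cast; field_simp
      rw [this, one_mul]
      have hsi : (s - 0)⁻¹ = (m : ℝ) + 1 := by rw [hsdef]; simp
      rw [hsi, norm_smul, Real.norm_of_nonneg hm.le]
      simp
      ring
    · refine (norm_mul_le _ _).trans ?_
      rw [mul_add, Real.exp_add]
      have hx := hexp (s • X)
      have hy := hexp (s • Y)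
      rw [norm_smul, Real.norm_of_nonneg hs0.le] at hx hy
      gcongr
    · refine (hexp _).trans ?_
      rw [norm_smul, Real.norm_of_nonneg hs0.le]
      gcongr
      exact norm_add_le _ _
  · have := (hslope.norm).const_mul (Real.exp (‖X‖ + ‖Y‖))
    simpa using this

/-- The orthogonal group `O(n)`; every compact Lie group is isomorphic to a closed subgroup of
some `O(n)`. -/
abbrev O (n : ℕ) := Matrix.orthogonalGroup (Fin n) ℝ

/-- The limit formula for matrices (whose topology is the usual one). -/
theorem tendsto_matrix_exp_mul_exp_pow {n : ℕ} (X Y : Matrix (Fin n) (Fin n) ℝ) :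
    Tendsto (fun m : ℕ => (NormedSpace.exp ((1 / ((m : ℝ) + 1)) • X) *
      NormedSpace.exp ((1 / ((m : ℝ) + 1)) • Y)) ^ (m + 1)) atTop
      (𝓝 (NormedSpace.exp (X + Y))) := by
  rcases Nat.eq_zero_or_pos n with h | h
  · subst h
    rw [show (fun m : ℕ => (NormedSpace.exp ((1 / ((m : ℝ) + 1)) • X) *
      NormedSpace.exp ((1 / ((m : ℝ) + 1)) • Y)) ^ (m + 1)) =
        fun _ => NormedSpace.exp (X + Y) from funext fun m => Subsingleton.elim _ _]
    exact tendsto_const_nhds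
  · have : Nonempty (Fin n) := ⟨⟨0, h⟩⟩
    let : NormedRing (Matrix (Fin n) (Fin n) ℝ) := Matrix.linftyOpNormedRing
    let : NormedAlgebra ℝ (Matrix (Fin n) (Fin n) ℝ) := Matrix.linftyOpNormedAlgebra
    have : NormOneClass (Matrix (Fin n) (Fin n) ℝ) := Matrix.linfty_opNormOneClass
    exact tendsto_exp_mul_exp_pow X Y

variable {n : ℕ}

/-- The Lie algebra `𝔨` of a closed subgroup `K ≤ O(n)`: the matrices `X` such that the one-parameter
group `t ↦ exp (t X)` lies in `K`. -/
def lieAlg (K : ClosedSubgroup (O n)) : Submodule ℝ (Matrix (Fin n) (Fin n) ℝ) where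
  carrier := {X | ∀ t : ℝ, ∃ k ∈ K, (k : Matrix (Fin n) (Fin n) ℝ) = NormedSpace.exp (t • X)}
  zero_mem' := fun t => ⟨1, one_mem K, by simp⟩
  smul_mem' := fun c X hX t => by
    obtain ⟨k, hk, h⟩ := hX (t * c)
    exact ⟨k, hk, by rw [h, mul_smul]⟩
  add_mem' := by
    intro X Y hX hY t
    choose a ha ha' using hX
    choose b hb hb' using hY
    have hO : IsClosed (Matrix.orthogonalGroup (Fin n) ℝ : Set (Matrix (Fin n) (Fin n) ℝ)) := by
      have : (Matrix.orthogonalGroup (Fin n) ℝ : Set (Matrix (Fin n) (Fin n) ℝ)) =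
          {M | M * star M = 1} := by
        ext M
        exact Matrix.mem_orthogonalGroup_iff (Fin n) ℝ
      rw [this]
      exact isClosed_eq (by fun_prop) continuous_const
    have hcl : IsClosed ((fun k : O n => (k : Matrix (Fin n) (Fin n) ℝ)) '' (K : Set (O n))) :=
      hO.isClosedEmbedding_subtypeVal.isClosedMap _ K.isClosed'
    have key := hcl.mem_of_tendsto (tendsto_matrix_exp_mul_exp_pow (t • X) (t • Y)) (by
      refine Eventually.of_forall fun m => ?_
      refine ⟨(a (1 / ((m : ℝ) + 1) * t) * b (1 / ((m : ℝ) + 1) * t)) ^ (m + 1),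
        pow_mem (mul_mem (ha _) (hb _)) _, ?_⟩
      simp only [SubmonoidClass.coe_pow, Submonoid.coe_mul, ha', hb',
        mul_smul])
    obtain ⟨k, hk, h⟩ := key
    exact ⟨k, hk, by rw [smul_add]; exact h⟩

/-- The exponential map `exp_K : 𝔨 → K`. -/
def expK (K : ClosedSubgroup (O n)) (X : lieAlg K) : K :=
  ⟨(X.2 1).choose, (X.2 1).choose_spec.1⟩

theorem coe_expK (K : ClosedSubgroup (O n)) (X : lieAlg K) :
    ((expK K X : O n) : Matrix (Fin n) (Fin n) ℝ) =
      NormedSpace.exp (X : Matrix (Fin n) (Fin n) ℝ) := by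
  have h : ((expK K X : O n) : Matrix (Fin n) (Fin n) ℝ) =
      NormedSpace.exp ((1 : ℝ) • (X : Matrix (Fin n) (Fin n) ℝ)) := (X.2 1).choose_spec.2
  rwa [one_smul] at h

/-- The adjoint representation `Ad_k X = k X k⁻¹` of `K` on `𝔨`. -/
def Ad (K : ClosedSubgroup (O n)) (k : K) : lieAlg K →ₗ[ℝ] lieAlg K where
  toFun X := ⟨((k : O n) : Matrix (Fin n) (Fin n) ℝ) * (X : Matrix (Fin n) (Fin n) ℝ) *
      (((k⁻¹ : K) : O n) : Matrix (Fin n) (Fin n) ℝ), fun t => by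
    obtain ⟨l, hl, h⟩ := X.2 t
    refine ⟨(k : O n) * l * ((k⁻¹ : K) : O n), mul_mem (mul_mem k.2 hl) (k⁻¹ : K).2, ?_⟩
    have h1 : ((k : O n) : Matrix (Fin n) (Fin n) ℝ) *
        (((k⁻¹ : K) : O n) : Matrix (Fin n) (Fin n) ℝ) = 1 :=
      congrArg (fun l : K => ((l : O n) : Matrix (Fin n) (Fin n) ℝ)) (mul_inv_cancel k)
    have hinv := Matrix.inv_eq_right_inv h1
    rw [← hinv, ← smul_mul_assoc, ← mul_smul_comm, Matrix.exp_conj _ _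
      (IsUnit.of_mul_eq_one _ h1), ← h, hinv]
    rfl⟩
  map_add' X Y := by
    ext1
    simp [mul_add, add_mul]
  map_smul' c X := by
    ext1
    simp

/-! ### The space `L²(𝕀, 𝔨)` -/

/-- The Lie algebra `𝔨` equipped with the inner product `B`. -/
def LieAlg (K : ClosedSubgroup (O n)) (_B : InnerProductSpace.Core ℝ (lieAlg K)) : Type := lieAlg K

variable (K : ClosedSubgroup (O n)) (B : InnerProductSpace.Core ℝ (lieAlg K))

instance : NormedAddCommGroup (LieAlg K B) :=
  @InnerProductSpace.Core.toNormedAddCommGroup ℝ (lieAlg K) _ _ _ B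

instance : InnerProductSpace ℝ (LieAlg K B) :=
  @InnerProductSpace.ofCore ℝ (lieAlg K) _ _ _ B.toCore

instance : FiniteDimensional ℝ (LieAlg K B) :=
  inferInstanceAs (FiniteDimensional ℝ (lieAlg K))

/-- The Hilbert space `L²(𝕀, 𝔨)`, where `𝕀 = [0, 1]` carries Lebesgue measure. -/
abbrev L2 := Lp (LieAlg K B) 2 ((volume : Measure ℝ).restrict (Set.Icc 0 1))

instance : MeasurableSpace (L2 K B) := borel _

instance : BorelSpace (L2 K B) := ⟨rfl⟩

/-- The step function equal to `v i` on the interval `[i/N, (i+1)/N)`, for `i < N`. -/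
def stepFun (N : ℕ) : (Fin N → LieAlg K B) →ₗ[ℝ] L2 K B where
  toFun v := ∑ i : Fin N, indicatorConstLp 2
    (measurableSet_Ico (a := (i : ℝ) / N) (b := ((i : ℝ) + 1) / N)) (measure_ne_top _ _) (v i)
  map_add' v w := by
    rw [← Finset.sum_add_distrib]
    exact Finset.sum_congr rfl fun i _ => indicatorConstLp_add.symm
  map_smul' c v := by
    rw [RingHom.id_apply, Finset.smul_sum]
    refine Finset.sum_congr rfl fun i _ => ?_
    rw [indicatorConstLp, indicatorConstLp, ← MemLp.toLp_const_smul]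
    refine MemLp.toLp_congr _ _ (Eventually.of_forall fun t => ?_)
    simp [Set.indicator_smul_apply]

/-- `V_N`: the space of functions that are constant a.e. on each of the `N` intervals of the uniform
partition of `𝕀`. -/
def stepSpace (N : ℕ) : Submodule ℝ (L2 K B) := LinearMap.range (stepFun K B N)

instance (N : ℕ) : FiniteDimensional ℝ (stepSpace K B N) :=
  inferInstanceAs (FiniteDimensional ℝ (LinearMap.range (stepFun K B N)))

/-- `ν_{N,R}`: the uniform probability measure on the ball of radius `R` of the Euclidean space
`V_N`, as a measure on `L²(𝕀, 𝔨)`. -/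
def nu (N : ℕ) (R : ℝ) : Measure (L2 K B) :=
  (ProbabilityTheory.cond (volume : Measure (stepSpace K B N)) (Metric.closedBall 0 R)).map
    (fun f : stepSpace K B N => (f : L2 K B))

/-! ### The product integral and the group law -/

/-- The product integral `∏_0^t exp f(s) ds` of the step function `f = stepFun N v`, namely
`exp ((t - t_j) v_j) exp ((t_j - t_{j-1}) v_{j-1}) ⋯ exp (t_1 v_0)` for `t_j ≤ t ≤ t_{j+1}`, where
`t_i = i/N`. The `i`-th factor is `exp (ℓ v_i)` with `ℓ` the length of `[0, t] ∩ [t_i, t_{i+1}]`; it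
is trivial for `i > j`. -/
def stepProd {N : ℕ} (v : Fin N → LieAlg K B) (t : ℝ) : K :=
  ((List.ofFn fun i : Fin N =>
    expK K (max 0 (min t (((i : ℝ) + 1) / N) - (i : ℝ) / N) • v i : LieAlg K B)).reverse).prod

/-- The product integral `∏_0^t exp f(s) ds ∈ K` of an arbitrary `f ∈ L²(𝕀, 𝔨)`: the extension by
continuity of the product integral of step functions, that is, its limit over the step functions
that tend to `f`. -/
def prodExp (f : L2 K B) (t : ℝ) : K :=
  limUnder (comap (fun p : (N : ℕ) × (Fin N → LieAlg K B) => stepFun K B p.1 p.2) (𝓝 f))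
    (fun p => stepProd K B p.2 t)

/-- The function `t ↦ Ad_{r(t)} g(t)`. -/
def AdFun (r : ℝ → K) (g : ℝ → LieAlg K B) (t : ℝ) : LieAlg K B := Ad K (r t) (g t)

open Classical in
/-- The group law `f ∗ g = f + Ad_{∏ exp f} g` of `L²(𝕀, 𝔨)`. As `t ↦ ∏_0^t exp f(s) ds` is
continuous with values in the compact group `K`, the function `t ↦ Ad_{∏_0^t exp f(s) ds} g(t)` is
always in `L²`. -/
def pathMul (f g : L2 K B) : L2 K B :=
  f + if h : MemLp (AdFun K B (prodExp K B f) g) 2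
        ((volume : Measure ℝ).restrict (Set.Icc 0 1))
      then h.toLp else 0

/-- `μ ∗ g`: the image of the measure `μ` under the right translation `f ↦ f ∗ g`. -/
def rightTranslate (μ : Measure (L2 K B)) (g : L2 K B) : Measure (L2 K B) :=
  μ.map (fun f => pathMul K B f g)

/-! ### Mass transportation distance -/

/-- The Monge–Kantorovich distance between `μ` and `ν` with regard to the metric
`min (dist x y) 1`: the infimum of the transportation cost over all couplings of `μ` and `ν`. -/
def mkDist {X : Type*} [PseudoMetricSpace X] [MeasurableSpace X] (μ ν : Measure X) : ℝ≥0∞ :=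
  ⨅ (π : Measure (X × X)) (_ : π.map Prod.fst = μ) (_ : π.map Prod.snd = ν),
    ∫⁻ p, ENNReal.ofReal (min (dist p.1 p.2) 1) ∂π

end PathGroup

end

open PathGroup

/-! In the coordinates `v : Fin N → 𝔨` the ball of radius `R` in `V_N` becomes the Euclidean ball of
radius `r = √N R`, and `f ↦ f ∗ g` becomes `v ↦ v + Ad_{Π exp v} g`, which leaves `V_N`. It is
compared with a map inside `V_N`: replace `g` by its samples `γ_i = g(i/N)` and freeze the product
integral at the left end of each interval, giving `T(v)_i = v_i + h_i(v)` with `h_i(v) =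
Ad_{∏_0^{i/N} exp v} γ_i`. If `‖γ_i‖ ≤ M`, the `L²` error on the ball is at most `‖γ - g‖ + C M R /
N` (`exists_norm_adLp_sub_stepFun_le`). It vanishes in the limit because `R = o(N)`.

Since `h_i` depends only on the `v_j` with `j < i`, the map `T` is triangular and preserves Lebesgue
measure (`measurePreserving_triangular`). The uniform measure on the ball is thus almost invariant
as soon as `T` moves only a small fraction of the ball outside it.

That is `volume_pBall_escape_le`. In `|T v|² = |v|² + 2 S(v) + ∑ ‖h_i‖²` the last term is at most `N
M²`, by invariance of the inner product. The terms of `S = ∑ ⟨v_i, h_i⟩` are orthogonal on the ball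
by the symmetry `v_j ↦ -v_j`, so `S` has second moment at most `M² r²`: far less than Cauchy–Schwarz
would give. Up to an outer shell of relative width `η`, holding a fraction at most `N d η` of the
volume (`d = dim 𝔨`), escape requires `S ≥ r² η / 4`, and Chebyshev bounds this by `16 M² / (r²
η²)`. With `η` a small multiple of `1/N` this is of order `N / R²`, small because `√N = o(R)`.

Finally `mkDist_map_le` turns the partial transport `T` into a coupling: what stays in the ball pays
the `L²` error, the rest pays at most its mass. -/

noncomputable section

namespace PathGroup

/-! ### Triangular maps and the Euclidean ball in a power of a Euclidean space -/

section Triangular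

open scoped Pointwise

/-- The Euclidean ball of radius `r` in `Eᴺ`. -/
def pBall (E : Type*) [NormedAddCommGroup E] (N : ℕ) (r : ℝ) : Set (Fin N → E) :=
  {v | ∑ i, ‖v i‖ ^ 2 ≤ r ^ 2}

theorem isClosed_pBall {E : Type*} [NormedAddCommGroup E] {N : ℕ} (r : ℝ) : IsClosed (pBall E N r) :=
  isClosed_le (by fun_prop) continuous_const

variable {E : Type*} [NormedAddCommGroup E] [InnerProductSpace ℝ E] [FiniteDimensional ℝ E]
  [MeasurableSpace E] [BorelSpace E] {N : ℕ}

open Function (update)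

/-- Adding to one coordinate a function of the other coordinates preserves Lebesgue measure. -/
theorem measurePreserving_shear (k : Fin N) {h : (Fin N → E) → E} (hm : Measurable h)
    (hk : ∀ v x, h (update v k x) = h v) :
    MeasurePreserving (fun v : Fin N → E => update v k (v k + h v)) := by
  have hS : Measurable (fun v : Fin N → E => update v k (v k + h v)) :=
    measurable_update'.comp (measurable_id.prodMk ((measurable_pi_apply k).add hm))
  refine ⟨hS, Measure.ext_of_lintegral _ fun f hf => ?_⟩
  rw [lintegral_map hf hS]
  -- Fubini: integrate coordinate `k` first. With the others fixed the map is a translation in that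
  -- coordinate.
  refine lintegral_eq_of_lmarginal_eq {k} (hf.comp hS) hf ?_
  rw [lmarginal_singleton, lmarginal_singleton]
  funext x
  simp only [hk, Function.update_self, Function.update_idem]
  exact lintegral_add_right_eq_self (fun y => f (update x k y)) (h x)

/-- A triangular map with unipotent linear part preserves Lebesgue measure. -/
theorem measurePreserving_triangular {h : Fin N → (Fin N → E) → E} (hm : ∀ i, Measurable (h i))
    (hdep : ∀ i v w, (∀ j < i, v j = w j) → h i v = h i w) :
    MeasurePreserving (fun v : Fin N → E => fun i => v i + h i v) := by
  have key : ∀ k ≤ N, MeasurePreserving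
      (fun v : Fin N → E => fun i : Fin N => if (i : ℕ) < k then v i + h i v else v i) := by
    intro k
    induction k with
    | zero => intro _; simpa using! MeasurePreserving.id _
    | succ k ih =>
      intro hk
      have hlow : ∀ (v : Fin N → E) (x : E) (j : Fin N), (j : ℕ) ≤ k →
          h j (update v ⟨k, hk⟩ x) = h j v := fun v x j hj =>
        hdep _ _ _ fun l hl => Function.update_of_ne
          (Fin.ne_of_lt (hl.trans_le (Fin.le_def.2 hj))) _ _
      have hs := measurePreserving_shear ⟨k, hk⟩ (hm ⟨k, hk⟩) fun v x => hlow v x _ le_rfl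
      -- The shear of the highest coordinate acts first. The later ones use `h j` with `j < k`,
      -- which do not see coordinate `k`, so every `h j` is still evaluated at the original `v`.
      convert (ih (by omega)).comp hs using 1
      funext v i
      rcases lt_trichotomy (i : ℕ) k with hi | hi | hi
      · have : i ≠ ⟨k, hk⟩ := fun e => by simp [e] at hi
        simp [hi, hi.trans (Nat.lt_succ_self k), hlow _ _ _ hi.le, this]
      · obtain rfl : i = ⟨k, hk⟩ := Fin.ext hi
        simp
      · have : i ≠ ⟨k, hk⟩ := fun e => by simp [e] at hi
        simp [hi.not_gt, this, show ¬ (i : ℕ) < k + 1 by omega]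
  simpa using key N le_rfl

/-- A function that is odd in one coordinate has integral zero. -/
theorem integral_eq_zero_of_odd_coord (j : Fin N) {G : (Fin N → E) → ℝ}
    (hG : ∀ v, G (update v j (-v j)) = -G v) : ∫ v, G v = 0 := by
  have hp : MeasurePreserving (fun v : Fin N → E => update v j (-v j)) := by
    have := measurePreserving_pi (fun _ : Fin N => (volume : Measure E)) (fun _ => volume)
      (f := fun i x => if i = j then -x else x) (fun i => by
        by_cases h : i = j
        · simpa [h] using Measure.measurePreserving_neg (volume : Measure E)
        · simpa [h] using! MeasurePreserving.id _)
    convert! this using 1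
    funext v i
    by_cases h : i = j
    · subst h; simp
    · simp [h]
  have hinv : Function.Involutive (fun v : Fin N → E => update v j (-v j)) := by
    intro v
    simp
  let e : (Fin N → E) ≃ᵐ (Fin N → E) := ⟨hinv.toPerm, hp.measurable, hp.measurable⟩
  have h1 : ∫ v, G (update v j (-v j)) = ∫ v, G v :=
    hp.integral_comp e.measurableEmbedding G
  simp only [hG, integral_neg] at h1
  linarith

theorem isCompact_pBall {E : Type*} [NormedAddCommGroup E] [InnerProductSpace ℝ E]
    [FiniteDimensional ℝ E] {N : ℕ} (r : ℝ) : IsCompact (pBall E N r) := by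
  refine (isCompact_closedBall (0 : Fin N → E) |r|).of_isClosed_subset (isClosed_pBall r) ?_
  intro v hv
  rw [mem_closedBall_zero_iff, pi_norm_le_iff_of_nonneg (abs_nonneg r)]
  intro i
  refine abs_le_of_sq_le_sq' ?_ (abs_nonneg r) |>.2
  rw [sq_abs]
  exact (Finset.single_le_sum (f := fun i => ‖v i‖ ^ 2) (fun _ _ => by positivity)
    (Finset.mem_univ i)).trans hv

theorem volume_pBall_ne_top (r : ℝ) : volume (pBall E N r) ≠ ⊤ :=
  (isCompact_pBall r).measure_lt_top.ne

theorem volume_pBall_pos {r : ℝ} (hr : 0 < r) : 0 < volume (pBall E N r) := by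
  have ho : IsOpen {v : Fin N → E | ∑ i, ‖v i‖ ^ 2 < r ^ 2} :=
    isOpen_lt (by fun_prop) continuous_const
  refine (ho.measure_pos volume ⟨0, by simpa using by positivity⟩).trans_le (measure_mono ?_)
  intro v hv
  have hv' : ∑ i, ‖v i‖ ^ 2 < r ^ 2 := hv
  exact hv'.le

theorem volume_pBall_mul {c r : ℝ} (hc : 0 < c) :
    volume (pBall E N (c * r)) =
      ENNReal.ofReal (c ^ (N * Module.finrank ℝ E)) * volume (pBall E N r) := by
  have h : pBall E N (c * r) = c • pBall E N r := by
    ext v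
    rw [Set.mem_smul_set_iff_inv_smul_mem₀ hc.ne']
    simp only [pBall, Set.mem_ofPred_eq, Pi.smul_apply, norm_smul, mul_pow, ← Finset.mul_sum,
      norm_inv, Real.norm_of_nonneg hc.le, inv_pow]
    rw [inv_mul_le_iff₀ (by positivity)]
  rw [h, Measure.addHaar_smul, abs_of_nonneg (by positivity),
    Module.finrank_pi_fintype, Finset.sum_const, Finset.card_univ, Fintype.card_fin, smul_eq_mul]

/-- The square of a sum of functions that are orthogonal on a set. -/
theorem setIntegral_sum_sq {X : Type*} [MeasurableSpace X] {μ : Measure X} {A : Set X}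
    {s : Fin N → X → ℝ} (hint : ∀ i j, IntegrableOn (fun v => s i v * s j v) A μ)
    (horth : ∀ i j, i < j → ∫ v in A, s i v * s j v ∂μ = 0) :
    ∫ v in A, (∑ i, s i v) ^ 2 ∂μ = ∑ i, ∫ v in A, s i v ^ 2 ∂μ := by
  have h1 : ∀ v, (∑ i, s i v) ^ 2 = ∑ i, ∑ j, s i v * s j v := fun v => by
    rw [sq, Finset.sum_mul_sum]
  simp only [h1]
  rw [integral_finsetSum _ fun i _ => integrable_finsetSum _ fun j _ => hint i j]
  refine Finset.sum_congr rfl fun i _ => ?_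
  rw [integral_finsetSum _ fun j _ => hint i j, Finset.sum_eq_single i]
  · simp only [sq]
  · intro j _ hj
    rcases lt_or_gt_of_ne hj with h | h
    · simp only [mul_comm (s i _)]
      exact horth j i h
    · exact horth i j h
  · simp

/-- The second moment on the ball of the pairing of a point with a predictable bounded field. -/
theorem setIntegral_sq_sum_inner_le {h : Fin N → (Fin N → E) → E} (hc : ∀ i, Continuous (h i))
    (hdep : ∀ i v w, (∀ j < i, v j = w j) → h i v = h i w) {M : ℝ}
    (hM : ∀ i v, ‖h i v‖ ≤ M) (r : ℝ) :
    ∫ v in pBall E N r, (∑ i, inner ℝ (v i) (h i v)) ^ 2 ≤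
      M ^ 2 * r ^ 2 * volume.real (pBall E N r) := by
  have hcont : ∀ i, Continuous fun v : Fin N → E => inner ℝ (v i) (h i v) := fun i =>
    (continuous_apply i).inner (hc i)
  have hmeas : MeasurableSet (pBall E N r) := (isClosed_pBall r).measurableSet
  have hco : ∀ {f : (Fin N → E) → ℝ}, Continuous f → IntegrableOn f (pBall E N r) := fun hf =>
    hf.continuousOn.integrableOn_compact (isCompact_pBall r)
  rw [setIntegral_sum_sq (fun i j => hco ((hcont i).mul (hcont j)))]
  · rw [← integral_finsetSum _ fun i _ => hco (f := fun v => inner ℝ (v i) (h i v) ^ 2)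
      ((hcont i).pow 2)]
    have hle : ∀ v ∈ pBall E N r, ∑ i, inner ℝ (v i) (h i v) ^ 2 ≤ M ^ 2 * r ^ 2 := by
      intro v hv
      calc ∑ i, inner ℝ (v i) (h i v) ^ 2 ≤ ∑ i, M ^ 2 * ‖v i‖ ^ 2 := by
            refine Finset.sum_le_sum fun i _ => ?_
            rw [← mul_pow, ← sq_abs]
            gcongr
            rw [mul_comm]
            exact (abs_real_inner_le_norm _ _).trans (by gcongr; exact hM i v)
        _ = M ^ 2 * ∑ i, ‖v i‖ ^ 2 := by rw [Finset.mul_sum]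
        _ ≤ M ^ 2 * r ^ 2 := by gcongr; exact hv
    refine (setIntegral_mono_on (hco (by fun_prop)) (hco continuous_const) hmeas hle).trans
      (le_of_eq ?_)
    simp [mul_comm]
  -- For `i < j` the reflection `v j ↦ -v j` fixes the ball, `v i`, `h i` and `h j`, and changes the
  -- sign of the product.
  · intro i j hij
    rw [← integral_indicator hmeas]
    refine integral_eq_zero_of_odd_coord j fun v => ?_
    have hmem : update v j (-v j) ∈ pBall E N r ↔ v ∈ pBall E N r := by
      have : ∀ i, ‖update v j (-v j) i‖ = ‖v i‖ := fun i => by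
        by_cases hi : i = j
        · subst hi; simp
        · simp [hi]
      simp [pBall, this]
    have hh : ∀ k ≤ j, h k (update v j (-v j)) = h k v := fun k hk =>
      hdep _ _ _ fun l hl => Function.update_of_ne (hl.trans_le hk).ne _ _
    by_cases hv : v ∈ pBall E N r
    · rw [Set.indicator_of_mem (hmem.2 hv), Set.indicator_of_mem hv, hh i hij.le, hh j le_rfl,
        Function.update_self, Function.update_of_ne hij.ne, inner_neg_left]
      ring
    · rw [Set.indicator_of_notMem (mt hmem.1 hv), Set.indicator_of_notMem hv, neg_zero]

/-- A small predictable perturbation moves few points out of the ball. -/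
theorem volume_pBall_escape_le {h : Fin N → (Fin N → E) → E} (hc : ∀ i, Continuous (h i))
    (hdep : ∀ i v w, (∀ j < i, v j = w j) → h i v = h i w) {M : ℝ}
    (hM : ∀ i v, ‖h i v‖ ≤ M) {r η : ℝ} (hr : 0 < r) (hη : 0 < η) (hη1 : η < 1)
    (hrη : 2 * (N * M ^ 2) ≤ r ^ 2 * η) :
    volume.real {v | v ∈ pBall E N r ∧ (fun i => v i + h i v) ∉ pBall E N r} ≤
      (N * Module.finrank ℝ E * η + 16 * M ^ 2 / (r ^ 2 * η ^ 2)) *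
        volume.real (pBall E N r) := by
  set A := pBall E N r with hA
  -- Points of the shell `A \ A'` are given up. A point of `A'` has room about `r² η`, of which `∑
  -- ‖h i v‖²` uses at most half by `hrη`; hence `2 S ≥ r² η / 2` on escape, which is the threshold
  -- `s` below.
  set A' := pBall E N ((1 - η) * r) with hA'
  set S : (Fin N → E) → ℝ := fun v => ∑ i, inner ℝ (v i) (h i v) with hS
  have hSc : Continuous S :=
    continuous_finsetSum _ fun i _ => (continuous_apply i).inner (hc i)
  have hmA : MeasurableSet A := (isClosed_pBall r).measurableSet
  have hmA' : MeasurableSet A' := (isClosed_pBall _).measurableSet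
  have hAA : A' ⊆ A := by
    intro v hv
    refine le_trans (show ∑ i, ‖v i‖ ^ 2 ≤ ((1 - η) * r) ^ 2 from hv) ?_
    gcongr
    nlinarith
  have hfin : volume A ≠ ⊤ := volume_pBall_ne_top r
  set s : ℝ := r ^ 2 * η / 4 with hs
  have hs0 : 0 < s := by positivity
  have hsub : {v | v ∈ A ∧ (fun i => v i + h i v) ∉ A} ⊆
      (A \ A') ∪ (A ∩ {v | s ^ 2 ≤ S v ^ 2}) := by
    rintro v ⟨hv, hTv⟩
    by_cases hv' : v ∈ A'
    · refine Or.inr ⟨hv, ?_⟩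
      have h1 : ∑ i, ‖v i + h i v‖ ^ 2 = ∑ i, ‖v i‖ ^ 2 + 2 * S v + ∑ i, ‖h i v‖ ^ 2 := by
        simp only [norm_add_sq_real, Finset.sum_add_distrib, hS, Finset.mul_sum]
      have h2 : ∑ i, ‖h i v‖ ^ 2 ≤ N * M ^ 2 := by
        calc ∑ i, ‖h i v‖ ^ 2 ≤ ∑ _i : Fin N, M ^ 2 := by
              refine Finset.sum_le_sum fun i _ => ?_
              gcongr
              exact hM i v
          _ = N * M ^ 2 := by simp
      have h3 : ∑ i, ‖v i‖ ^ 2 ≤ ((1 - η) * r) ^ 2 := hv'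
      have h4 : r ^ 2 < ∑ i, ‖v i + h i v‖ ^ 2 := not_le.1 hTv
      have h5 : ((1 - η) * r) ^ 2 ≤ (1 - η) * r ^ 2 := by
        rw [mul_pow]
        gcongr
        nlinarith
      have h6 : s ≤ S v := by
        rw [hs]
        linarith
      exact pow_le_pow_left₀ hs0.le h6 2
    · exact Or.inl ⟨hv, hv'⟩
  have hshell : volume.real (A \ A') ≤ N * Module.finrank ℝ E * η * volume.real A := by
    rw [measureReal_sdiff hAA hmA']
    have : volume.real A' = (1 - η) ^ (N * Module.finrank ℝ E) * volume.real A := by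
      rw [measureReal_def, hA', volume_pBall_mul (by linarith), ENNReal.toReal_mul,
        ENNReal.toReal_ofReal (pow_nonneg (by linarith) _), measureReal_def]
    rw [this]
    -- Bernoulli: the shell has relative volume `1 - (1 - η)^(N d) ≤ N d η`.
    have hb := one_add_mul_le_pow (a := -η) (by linarith) (N * Module.finrank ℝ E)
    push_cast at hb
    rw [← sub_eq_add_neg] at hb
    nlinarith [measureReal_nonneg (μ := volume) (s := A)]
  have hcheb : volume.real (A ∩ {v | s ^ 2 ≤ S v ^ 2}) ≤
      16 * M ^ 2 / (r ^ 2 * η ^ 2) * volume.real A := by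
    have hint : IntegrableOn (fun v => S v ^ 2) A :=
      (hSc.pow 2).continuousOn.integrableOn_compact (isCompact_pBall r)
    have hm := mul_meas_ge_le_integral_of_nonneg (μ := volume.restrict A)
      (Eventually.of_forall fun v => sq_nonneg (S v)) hint (s ^ 2)
    have hms : MeasurableSet {v | s ^ 2 ≤ S v ^ 2} :=
      (isClosed_le continuous_const (hSc.pow 2)).measurableSet
    rw [measureReal_restrict_apply hms, Set.inter_comm] at hm
    have hle := hm.trans (setIntegral_sq_sum_inner_le hc hdep hM r)
    have e : 16 * M ^ 2 / (r ^ 2 * η ^ 2) * volume.real A =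
        (M ^ 2 * r ^ 2 * volume.real A) / s ^ 2 := by
      rw [hs]
      field_simp
      ring
    rw [e, le_div_iff₀ (by positivity), mul_comm]
    exact hle
  calc volume.real {v | v ∈ A ∧ (fun i => v i + h i v) ∉ A}
      ≤ volume.real ((A \ A') ∪ (A ∩ {v | s ^ 2 ≤ S v ^ 2})) :=
        measureReal_mono hsub (measure_ne_top_of_subset
          (Set.union_subset Set.sdiff_subset Set.inter_subset_left) hfin)
    _ ≤ volume.real (A \ A') + volume.real (A ∩ {v | s ^ 2 ≤ S v ^ 2}) :=
        measureReal_union_le _ _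
    _ ≤ _ := by rw [add_mul]; exact add_le_add hshell hcheb

end Triangular

end PathGroup

namespace PathGroup

/-! ### Couplings and transportation distance -/

section Coupling

variable {X Y : Type*} [MeasurableSpace X] [MeasurableSpace Y] [PseudoMetricSpace Y]

/-- A partial transport map gives a bound for the transportation distance: couple `J (T x)` with
`Φ x` for `x ∈ A`, and independently what remains. -/
theorem mkDist_map_le {p : Measure X} [IsProbabilityMeasure p] {T : X → X} {J Φ : X → Y}
    (hT : Measurable T) (hJ : Measurable J) (hΦ : Measurable Φ) {A : Set X} (hA : MeasurableSet A)
    (hle : (p.restrict A).map T ≤ p) {ε : ℝ} (hd : ∀ x ∈ A, dist (J (T x)) (Φ x) ≤ ε) :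
    mkDist (p.map J) (p.map Φ) ≤ ENNReal.ofReal ε + p Aᶜ := by
  set σ := (p.restrict A).map T with hσ
  set ρ := p - σ with hρ
  have hρσ : ρ + σ = p := Measure.sub_add_cancel_of_le hle
  have hσu : σ Set.univ = p A := by
    rw [hσ, Measure.map_apply hT MeasurableSet.univ]
    simp
  have hρu : ρ Set.univ = p Aᶜ := by
    rw [hρ, Measure.sub_apply MeasurableSet.univ hle, hσu, prob_compl_eq_one_sub hA, measure_univ]
  have : IsFiniteMeasure ρ := ⟨by rw [hρu]; exact measure_lt_top _ _⟩
  set τ : Measure X := p.restrict Aᶜ with hτ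
  have hτu : τ Set.univ = p Aᶜ := by simp [hτ]
  -- The untransported parts `ρ` and `τ` both have mass `δ`, so `δ⁻¹` normalizes their product to
  -- the right marginals. If `δ = 0`, then `δ⁻¹ = ⊤`, but both parts are zero.
  set δ := p Aᶜ with hδ
  have hδt : δ ≠ ⊤ := measure_ne_top _ _
  have hfst : δ⁻¹ • (δ • ρ.map J) = ρ.map J := by
    by_cases h0 : δ = 0
    · have : ρ = 0 := Measure.measure_univ_eq_zero.1 (hρu.trans h0)
      simp [this]
    · rw [smul_smul, ENNReal.inv_mul_cancel h0 hδt, one_smul]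
  have hsnd : δ⁻¹ • (δ • τ.map Φ) = τ.map Φ := by
    by_cases h0 : δ = 0
    · have : τ = 0 := Measure.measure_univ_eq_zero.1 (hτu.trans h0)
      simp [this]
    · rw [smul_smul, ENNReal.inv_mul_cancel h0 hδt, one_smul]
  have hpair : Measurable fun x => (J (T x), Φ x) := (hJ.comp hT).prodMk hΦ
  set π : Measure (Y × Y) := (p.restrict A).map (fun x => (J (T x), Φ x)) +
    δ⁻¹ • (ρ.map J).prod (τ.map Φ) with hπ
  have hπ1 : π.map Prod.fst = p.map J := by
    rw [hπ, Measure.map_add _ _ measurable_fst, Measure.map_map measurable_fst hpair,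
      Measure.map_smul, Measure.map_fst_prod, Measure.map_apply hΦ MeasurableSet.univ,
      Set.preimage_univ, hτu, hfst]
    conv_rhs => rw [← hρσ, Measure.map_add _ _ hJ, add_comm, hσ, Measure.map_map hJ hT]
    rfl
  have hπ2 : π.map Prod.snd = p.map Φ := by
    rw [hπ, Measure.map_add _ _ measurable_snd, Measure.map_map measurable_snd hpair,
      Measure.map_smul, Measure.map_snd_prod, Measure.map_apply hJ MeasurableSet.univ,
      Set.preimage_univ, hρu, hsnd]
    conv_rhs => rw [← Measure.restrict_add_restrict_compl (μ := p) hA, Measure.map_add _ _ hΦ]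
    rfl
  refine (iInf₂_le_of_le π hπ1 (iInf_le_of_le hπ2 le_rfl)).trans ?_
  rw [hπ, lintegral_add_measure, lintegral_smul_measure]
  refine add_le_add ?_ ?_
  · refine (lintegral_map_le _ _).trans ?_
    calc ∫⁻ x in A, ENNReal.ofReal (min (dist (J (T x)) (Φ x)) 1) ∂p
        ≤ ∫⁻ _x in A, ENNReal.ofReal ε ∂p :=
          setLIntegral_mono measurable_const fun x hx =>
            ENNReal.ofReal_le_ofReal ((min_le_left _ _).trans (hd x hx))
      _ ≤ ENNReal.ofReal ε := by
          rw [setLIntegral_const]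
          exact mul_le_of_le_one_right zero_le prob_le_one
  · calc δ⁻¹ • ∫⁻ q, ENNReal.ofReal (min (dist q.1 q.2) 1) ∂((ρ.map J).prod (τ.map Φ))
        ≤ δ⁻¹ • ∫⁻ _q, 1 ∂((ρ.map J).prod (τ.map Φ)) := by
          refine mul_le_mul_right (lintegral_mono fun q => ?_) _
          rw [← ENNReal.ofReal_one]
          exact ENNReal.ofReal_le_ofReal (min_le_right _ _)
      _ = δ⁻¹ * (δ * δ) := by
          rw [lintegral_one, ← Set.univ_prod_univ, Measure.prod_prod,
            Measure.map_apply hJ MeasurableSet.univ, Measure.map_apply hΦ MeasurableSet.univ,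
            Set.preimage_univ, Set.preimage_univ, hρu, hτu, smul_eq_mul]
      _ ≤ δ := by
          rw [← mul_assoc]
          exact mul_le_of_le_one_left zero_le (ENNReal.inv_mul_le_one _)

/-- Bounded Lipschitz functions separate measures at most by their transportation distance. -/
theorem abs_integral_sub_integral_le [BorelSpace Y] {μ ν : Measure Y} [IsFiniteMeasure μ]
    [IsFiniteMeasure ν] {η : ℝ} (hη : 0 ≤ η) (h : mkDist μ ν < ENNReal.ofReal η) {F : Y → ℝ}
    (hF : LipschitzWith 1 F) (hb : ∀ y, |F y| ≤ 1) :
    |∫ y, F y ∂μ - ∫ y, F y ∂ν| ≤ 2 * η := by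
  simp only [mkDist, iInf_lt_iff] at h
  obtain ⟨π, h1, h2, h3⟩ := h
  have hFm : Measurable F := hF.continuous.measurable
  have hfin : IsFiniteMeasure π := ⟨by
    have := congrArg (fun m : Measure Y => m Set.univ) h1
    simp only [Measure.map_apply measurable_fst MeasurableSet.univ, Set.preimage_univ] at this
    rw [this]
    exact measure_lt_top _ _⟩
  have hi : ∀ {f : Y × Y → Y}, Measurable f → Integrable (fun q => F (f q)) π := fun hf =>
    Integrable.of_bound (hFm.comp hf).aestronglyMeasurable 1 (Eventually.of_forall fun q => hb _)
  rw [← h1, ← h2, integral_map measurable_fst.aemeasurable hFm.aestronglyMeasurable,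
    integral_map measurable_snd.aemeasurable hFm.aestronglyMeasurable,
    ← integral_sub (hi measurable_fst) (hi measurable_snd), ← Real.norm_eq_abs]
  rw [← ENNReal.ofReal_le_ofReal_iff (by positivity), ofReal_norm]
  refine (enorm_integral_le_lintegral_enorm _).trans ?_
  calc ∫⁻ q, ‖F q.1 - F q.2‖ₑ ∂π
      ≤ ∫⁻ q, 2 * ENNReal.ofReal (min (dist q.1 q.2) 1) ∂π := by
        refine lintegral_mono fun q => ?_
        dsimp only
        rw [← ofReal_norm, ← ENNReal.ofReal_ofNat 2,
          ← ENNReal.ofReal_mul (by norm_num)]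
        -- The increment of `F` is at most `min d 2`, hence at most `2 min d 1`; this is the factor
        -- `2` in the bound.
        refine ENNReal.ofReal_le_ofReal ?_
        have ha := hF.dist_le_mul q.1 q.2
        rw [Real.dist_eq] at ha
        have hb1 := abs_le.1 (hb q.1)
        have hb2 := abs_le.1 (hb q.2)
        rw [mul_min_of_nonneg _ _ (by norm_num), Real.norm_eq_abs]
        refine le_min ?_ (abs_le.2 ⟨by linarith, by linarith⟩)
        have := dist_nonneg (x := q.1) (y := q.2)
        simp only [NNReal.coe_one, one_mul] at ha
        linarith
    _ = 2 * ∫⁻ q, ENNReal.ofReal (min (dist q.1 q.2) 1) ∂π :=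
        lintegral_const_mul' _ _ (by norm_num)
    _ ≤ ENNReal.ofReal (2 * η) := by
        rw [ENNReal.ofReal_mul (by norm_num), ENNReal.ofReal_ofNat]
        gcongr

/-- A measure preserving map does not increase the uniform distribution on a set, on the part of
that set which it maps into the set. -/
theorem map_restrict_cond_le {μ : Measure X} {T : X → X} (hT : MeasurePreserving T μ μ) {A : Set X}
    (hA : MeasurableSet A) :
    ((ProbabilityTheory.cond μ A).restrict (A ∩ T ⁻¹' A)).map T ≤ ProbabilityTheory.cond μ A := by
  refine Measure.le_iff.2 fun s hs => ?_
  rw [Measure.map_apply hT.measurable hs, Measure.restrict_apply (hT.measurable hs),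
    ProbabilityTheory.cond_apply hA, ProbabilityTheory.cond_apply hA]
  refine mul_le_mul_right ?_ _
  calc μ (A ∩ (T ⁻¹' s ∩ (A ∩ T ⁻¹' A))) ≤ μ (T ⁻¹' (A ∩ s)) :=
        measure_mono fun x hx => ⟨hx.2.2.2, hx.2.1⟩
    _ = μ (A ∩ s) := hT.measure_preimage (hA.inter hs).nullMeasurableSet

end Coupling

end PathGroup

namespace PathGroup

open scoped Matrix.Norms.L2Operator

variable {n : ℕ} (K : ClosedSubgroup (O n)) (B : InnerProductSpace.Core ℝ (lieAlg K))

/-! ### Orthogonal matrices and the exponential map -/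

section Matrices

variable {K}

/-- An element of `K` as a matrix. -/
def mat (k : K) : Matrix (Fin n) (Fin n) ℝ := ((k : O n) : Matrix (Fin n) (Fin n) ℝ)

theorem isInducing_mat : IsInducing (mat : K → Matrix (Fin n) (Fin n) ℝ) :=
  IsInducing.subtypeVal.comp IsInducing.subtypeVal

theorem mat_mul (k l : K) : mat (k * l) = mat k * mat l := rfl

instance : ContinuousMul K := ⟨by
  rw [isInducing_mat.continuous_iff]
  exact (isInducing_mat.continuous.comp continuous_fst).mul
    (isInducing_mat.continuous.comp continuous_snd)⟩

theorem mat_one : mat (1 : K) = 1 := rfl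

theorem mat_inv (k : K) : mat k⁻¹ = star (mat k) := rfl

theorem mat_mem_unitary (k : K) : mat k ∈ unitary (Matrix (Fin n) (Fin n) ℝ) := (k : O n).2

theorem norm_mat_mul (k : K) (A : Matrix (Fin n) (Fin n) ℝ) : ‖mat k * A‖ = ‖A‖ :=
  CStarRing.norm_mem_unitary_mul A (mat_mem_unitary k)

theorem norm_mul_mat (k : K) (A : Matrix (Fin n) (Fin n) ℝ) : ‖A * mat k‖ = ‖A‖ :=
  CStarRing.norm_mul_mem_unitary A (mat_mem_unitary k)

/-- Telescoping. Multiplication by orthogonal matrices is isometric for the operator norm, so errors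
add up without being amplified. -/
theorem norm_mat_pow_sub_mat_pow_le (k l : K) (m : ℕ) :
    ‖mat k ^ m - mat l ^ m‖ ≤ m * ‖mat k - mat l‖ := by
  induction m with
  | zero => simp
  | succ m ih =>
    have e : mat k ^ (m + 1) - mat l ^ (m + 1) =
        mat (k ^ m) * (mat k - mat l) + (mat k ^ m - mat l ^ m) * mat l := by
      have : mat (k ^ m) = mat k ^ m := rfl
      rw [this, pow_succ, pow_succ]
      noncomm_ring
    rw [e]
    refine (norm_add_le _ _).trans ?_
    rw [norm_mat_mul, norm_mul_mat]
    push_cast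
    linarith

theorem mat_expK (X : lieAlg K) : mat (expK K X) = NormedSpace.exp X.1 := coe_expK K X

/-- A global Lipschitz bound follows from one at the origin: `exp X` is the `(m+1)`-st power of `exp
(X/(m+1))`, and the linear growth of the error under powers in an orthogonal group cancels the
scaling. -/
theorem norm_mat_expK_sub_le (X Y : lieAlg K) :
    ‖mat (expK K X) - mat (expK K Y)‖ ≤ 2 * ‖X.1 - Y.1‖ := by
  have hd : HasStrictFDerivAt (NormedSpace.exp : Matrix (Fin n) (Fin n) ℝ → _)
      (1 : Matrix (Fin n) (Fin n) ℝ →L[ℝ] Matrix (Fin n) (Fin n) ℝ) 0 :=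
    hasStrictFDerivAt_exp_zero
  -- The derivative at `0` is the identity, of norm at most `1` (it may be `0` when `n = 0`), so any
  -- constant above `1` works near `0`.
  obtain ⟨s, hs, hlip⟩ := hd.exists_lipschitzOnWith_of_nnnorm_lt 2 (by
    refine lt_of_le_of_lt (b := 1) ?_ (by norm_num)
    exact ContinuousLinearMap.norm_id_le)
  have hlim : ∀ Z : Matrix (Fin n) (Fin n) ℝ,
      Tendsto (fun m : ℕ => (1 / ((m : ℝ) + 1)) • Z) atTop (𝓝 0) := fun Z => by
    simpa using (tendsto_one_div_add_atTop_nhds_zero_nat (𝕜 := ℝ)).smul_const Z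
  obtain ⟨m, hmX, hmY⟩ := (((hlim X.1).eventually hs).and ((hlim Y.1).eventually hs)).exists
  set c : ℝ := 1 / ((m : ℝ) + 1) with hc
  have hc0 : 0 < c := by positivity
  have hroot : ∀ Z : lieAlg K, mat (expK K Z) = mat (expK K (c • Z)) ^ (m + 1) := fun Z => by
    rw [mat_expK, mat_expK, ← Matrix.exp_nsmul, Submodule.coe_smul, ← Nat.cast_smul_eq_nsmul ℝ,
      smul_smul, hc]
    have : ((m + 1 : ℕ) : ℝ) * (1 / ((m : ℝ) + 1)) = 1 := by push_cast; field_simp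
    rw [this, one_smul]
  rw [hroot X, hroot Y]
  refine (norm_mat_pow_sub_mat_pow_le _ _ _).trans ?_
  rw [mat_expK, mat_expK]
  have := hlip.dist_le_mul _ hmX _ hmY
  rw [dist_eq_norm, dist_eq_norm, ← smul_sub, norm_smul, Real.norm_of_nonneg hc0.le] at this
  calc ((m + 1 : ℕ) : ℝ) * ‖NormedSpace.exp ((c • X : lieAlg K) : Matrix (Fin n) (Fin n) ℝ) -
        NormedSpace.exp ((c • Y : lieAlg K) : Matrix (Fin n) (Fin n) ℝ)‖
      ≤ ((m + 1 : ℕ) : ℝ) * (2 * (c * ‖X.1 - Y.1‖)) := by gcongr; exact this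
    _ = 2 * ‖X.1 - Y.1‖ := by rw [hc]; push_cast; field_simp

theorem norm_mat_expK_sub_one_le (X : lieAlg K) : ‖mat (expK K X) - 1‖ ≤ 2 * ‖X.1‖ := by
  have h := norm_mat_expK_sub_le X 0
  rw [mat_expK 0] at h
  simpa using h

theorem expK_add_smul (a b : ℝ) (X : lieAlg K) :
    expK K ((a + b) • X) = expK K (a • X) * expK K (b • X) := by
  refine Subtype.ext (Subtype.ext ?_)
  change mat (expK K ((a + b) • X)) = mat (expK K (a • X)) * mat (expK K (b • X))
  rw [mat_expK, mat_expK, mat_expK, Submodule.coe_smul, add_smul, Matrix.exp_add_of_commute]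
  · rfl
  · exact ((Commute.refl X.1).smul_left a).smul_right b

theorem expK_zero : expK K 0 = 1 := by
  refine Subtype.ext (Subtype.ext ?_)
  change mat (expK K 0) = mat 1
  rw [mat_expK, mat_one]
  simp

end Matrices

/-! ### The Lie algebra and its adjoint representation -/

section LieAlgebra

/-- The inclusion of the Lie algebra into the matrices. -/
def lieMat : LieAlg K B →ₗ[ℝ] Matrix (Fin n) (Fin n) ℝ := (lieAlg K).subtype

theorem lieMat_injective : Function.Injective (lieMat K B) := Subtype.val_injective

theorem isInducing_lieMat : IsInducing (lieMat K B) :=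
  ((lieMat K B).isClosedEmbedding_of_injective
    (LinearMap.ker_eq_bot.2 (lieMat_injective K B))).isInducing

theorem continuous_lieMat : Continuous (lieMat K B) := (isInducing_lieMat K B).continuous

theorem exists_norm_lieMat_le : ∃ C > 0, ∀ X, ‖lieMat K B X‖ ≤ C * ‖X‖ :=
  (LinearMap.toContinuousLinearMap (lieMat K B)).bound

theorem exists_norm_le_norm_lieMat : ∃ C > 0, ∀ X, ‖X‖ ≤ C * ‖lieMat K B X‖ := by
  obtain ⟨C, hC, h⟩ := (lieMat K B).exists_antilipschitzWith
    (LinearMap.ker_eq_bot.2 (lieMat_injective K B))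
  exact ⟨C, by exact_mod_cast hC, fun X => by simpa using h.le_mul_dist X 0⟩

/-- The adjoint representation on the Lie algebra with its inner product. -/
def AdB (k : K) : LieAlg K B →ₗ[ℝ] LieAlg K B := Ad K k

theorem lieMat_AdB (k : K) (X : LieAlg K B) :
    lieMat K B (AdB K B k X) = mat k * lieMat K B X * mat k⁻¹ := rfl

theorem continuous_AdB : Continuous fun q : K × LieAlg K B => AdB K B q.1 q.2 := by
  rw [(isInducing_lieMat K B).continuous_iff]
  have h1 : Continuous fun q : K × LieAlg K B => mat q.1 :=
    isInducing_mat.continuous.comp continuous_fst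
  have h2 : Continuous fun q : K × LieAlg K B => lieMat K B q.2 :=
    (continuous_lieMat K B).comp continuous_snd
  exact (h1.mul h2).mul h1.star

theorem norm_AdB (hB : ∀ (k : K) (X Y : lieAlg K), B.inner (Ad K k X) (Ad K k Y) = B.inner X Y)
    (k : K) (X : LieAlg K B) : ‖AdB K B k X‖ = ‖X‖ := by
  have h : inner ℝ (AdB K B k X) (AdB K B k X) = inner ℝ X X := hB k X X
  rw [real_inner_self_eq_norm_sq, real_inner_self_eq_norm_sq] at h
  exact (sq_eq_sq₀ (norm_nonneg _) (norm_nonneg _)).1 h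

/-- The inverse is the transpose, so `k⁻¹ - l⁻¹` is as small as `k - l`, and each of the two terms
of the product rule costs one factor `‖mat k - mat l‖`. The constant converts between the operator
norm and the norm of `B`. -/
theorem exists_norm_AdB_sub_le :
    ∃ C > 0, ∀ (k l : K) (X : LieAlg K B),
      ‖AdB K B k X - AdB K B l X‖ ≤ C * ‖mat k - mat l‖ * ‖X‖ := by
  obtain ⟨C₁, hC₁, h₁⟩ := exists_norm_lieMat_le K B
  obtain ⟨C₂, hC₂, h₂⟩ := exists_norm_le_norm_lieMat K B
  refine ⟨C₂ * 2 * C₁, by positivity, fun k l X => (h₂ _).trans ?_⟩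
  set x := lieMat K B X with hx
  have e : lieMat K B (AdB K B k X - AdB K B l X) =
      (mat k - mat l) * x * mat k⁻¹ + mat l * (x * (mat k⁻¹ - mat l⁻¹)) := by
    rw [map_sub, lieMat_AdB, lieMat_AdB]
    noncomm_ring
  have hinv : ‖mat k⁻¹ - mat l⁻¹‖ = ‖mat k - mat l‖ := by
    rw [mat_inv, mat_inv, ← star_sub, norm_star]
  have h3 : ‖lieMat K B (AdB K B k X - AdB K B l X)‖ ≤ 2 * ‖mat k - mat l‖ * ‖x‖ := by
    rw [e]
    refine (norm_add_le _ _).trans ?_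
    rw [norm_mul_mat, norm_mat_mul]
    have a := norm_mul_le (mat k - mat l) x
    have b := norm_mul_le x (mat k⁻¹ - mat l⁻¹)
    rw [hinv] at b
    linarith
  calc C₂ * ‖lieMat K B (AdB K B k X - AdB K B l X)‖
      ≤ C₂ * (2 * ‖mat k - mat l‖ * (C₁ * ‖X‖)) := by
        gcongr
        exact h3.trans (by gcongr; exact h₁ X)
    _ = _ := by ring

theorem continuous_expK : Continuous fun X : LieAlg K B => expK K X := by
  rw [isInducing_mat.continuous_iff]
  have : (mat ∘ fun X : LieAlg K B => expK K X) = fun X => NormedSpace.exp (lieMat K B X) :=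
    funext fun X => mat_expK (K := K) X
  rw [this]
  let : NormedAlgebra ℚ (Matrix (Fin n) (Fin n) ℝ) := NormedAlgebra.restrictScalars ℚ ℝ _
  exact NormedSpace.exp_continuous.comp (continuous_lieMat K B)

end LieAlgebra

/-! ### Product integrals of step functions -/

section ProductIntegral

variable {K} {N : ℕ}

theorem prod_reverse_ofFn_succ {G : Type*} [Monoid G] (a : Fin (N + 1) → G) :
    (List.ofFn a).reverse.prod = (List.ofFn fun i : Fin N => a i.succ).reverse.prod * a 0 := by
  rw [List.ofFn_succ, List.reverse_cons, List.prod_append, List.prod_singleton]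

theorem prod_reverse_ofFn_eq_one {G : Type*} [Monoid G] {a : Fin N → G} (h : ∀ i, a i = 1) :
    (List.ofFn a).reverse.prod = 1 := by
  refine List.prod_eq_one fun x hx => ?_
  rw [List.mem_reverse, List.mem_ofFn] at hx
  obtain ⟨i, rfl⟩ := hx
  exact h i

/-- The effect on an ordered product of changing its last nontrivial factor. -/
theorem prod_reverse_ofFn_eq_mul {G : Type*} [Monoid G] {a b : Fin N → G} {e : G} (i : Fin N)
    (hlt : ∀ j < i, a j = b j) (hi : a i = e * b i) (ha : ∀ j, i < j → a j = 1)
    (hb : ∀ j, i < j → b j = 1) :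
    (List.ofFn a).reverse.prod = e * (List.ofFn b).reverse.prod := by
  induction N with
  | zero => exact i.elim0
  | succ N ih =>
    rw [prod_reverse_ofFn_succ, prod_reverse_ofFn_succ]
    rcases Fin.eq_zero_or_eq_succ i with rfl | ⟨k, rfl⟩
    · rw [prod_reverse_ofFn_eq_one fun j => ha _ j.succ_pos,
        prod_reverse_ofFn_eq_one fun j => hb _ j.succ_pos, hi, one_mul, one_mul]
    · rw [ih k (fun j hj => hlt _ (Fin.succ_lt_succ_iff.2 hj)) hi
        (fun j hj => ha _ (Fin.succ_lt_succ_iff.2 hj))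
        (fun j hj => hb _ (Fin.succ_lt_succ_iff.2 hj)), hlt 0 k.succ_pos, mul_assoc]

theorem continuous_prod_reverse_ofFn {X G : Type*} [TopologicalSpace X] [TopologicalSpace G]
    [Monoid G] [ContinuousMul G] {a : X → Fin N → G} (h : ∀ i, Continuous fun x => a x i) :
    Continuous fun x => (List.ofFn (a x)).reverse.prod := by
  induction N with
  | zero => simpa using continuous_const
  | succ N ih =>
    simp only [prod_reverse_ofFn_succ]
    exact (ih fun i => h i.succ).mul (h 0)

theorem continuous_stepProd : Continuous fun q : (Fin N → LieAlg K B) × ℝ =>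
    stepProd K B q.1 q.2 := by
  refine continuous_prod_reverse_ofFn fun i => (continuous_expK K B).comp ?_
  exact (by fun_prop : Continuous fun q : (Fin N → LieAlg K B) × ℝ =>
    max 0 (min q.2 (((i : ℝ) + 1) / N) - (i : ℝ) / N)).smul
      ((continuous_apply i).comp continuous_fst)

/-- At time `i/N` the factors with index at least `i` have length `0`. This is what makes the frozen
translation triangular. -/
theorem stepProd_congr (i : Fin N) {v w : Fin N → LieAlg K B} (h : ∀ j < i, v j = w j) :
    stepProd K B v ((i : ℝ) / N) = stepProd K B w ((i : ℝ) / N) := by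
  unfold stepProd
  congr 3
  funext j
  by_cases hj : j < i
  · rw [h j hj]
  · have : max 0 (min ((i : ℝ) / N) (((j : ℝ) + 1) / N) - (j : ℝ) / N) = 0 := by
      refine max_eq_left (sub_nonpos.2 ((min_le_left _ _).trans ?_))
      gcongr
      exact_mod_cast not_lt.1 hj
    rw [this, zero_smul, zero_smul]

theorem stepProd_zero (v : Fin N → LieAlg K B) : stepProd K B v 0 = 1 := by
  refine prod_reverse_ofFn_eq_one fun i => ?_
  have : max 0 (min 0 (((i : ℝ) + 1) / N) - (i : ℝ) / N) = 0 := by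
    refine max_eq_left (sub_nonpos.2 ((min_le_left _ _).trans ?_))
    positivity
  rw [this, zero_smul]
  exact expK_zero

/-- Within one interval of the partition the product integral is a one-parameter group. -/
theorem stepProd_eq_mul (v : Fin N → LieAlg K B) (i : Fin N) {s t : ℝ} (hs : (i : ℝ) / N ≤ s)
    (hst : s ≤ t) (ht : t ≤ ((i : ℝ) + 1) / N) :
    stepProd K B v t = expK K ((t - s) • v i : LieAlg K B) * stepProd K B v s := by
  have hN : (0 : ℝ) < N := by exact_mod_cast i.pos
  refine prod_reverse_ofFn_eq_mul i (fun j hj => ?_) ?_ (fun j hj => ?_) (fun j hj => ?_)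
  · have : ((j : ℝ) + 1) / N ≤ i / N := by
      gcongr
      exact_mod_cast hj
    rw [min_eq_right (this.trans hs), min_eq_right (this.trans (hs.trans hst))]
  · rw [min_eq_left ht, min_eq_left (hst.trans ht), max_eq_right (by linarith),
      max_eq_right (by linarith)]
    have := expK_add_smul (K := K) (t - s) (s - i / N) (v i)
    rw [show t - s + (s - i / N) = t - (i : ℝ) / N by ring] at this
    exact this
  all_goals
    have hij : ((i : ℝ) + 1) / N ≤ j / N := by
      gcongr
      exact_mod_cast hj
    rw [max_eq_left (sub_nonpos.2 ((min_le_left _ _).trans (by linarith))), zero_smul]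
    exact expK_zero

end ProductIntegral

end PathGroup

namespace PathGroup

open scoped Matrix.Norms.L2Operator

/-! ### Pointwise representatives of step functions -/

section StepVal

variable {E : Type*} [NormedAddCommGroup E] {N : ℕ}

/-- The step function with value `v i` on `[i/N, (i+1)/N)`, as a function on the line. -/
def stepVal (v : Fin N → E) (t : ℝ) : E :=
  ∑ i : Fin N, (Set.Ico ((i : ℝ) / N) (((i : ℝ) + 1) / N)).indicator (fun _ => v i) t

theorem eq_of_mem_Ico_div {i j : Fin N} {t : ℝ}
    (hi : t ∈ Set.Ico ((i : ℝ) / N) (((i : ℝ) + 1) / N))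
    (hj : t ∈ Set.Ico ((j : ℝ) / N) (((j : ℝ) + 1) / N)) : i = j := by
  have hN : (0 : ℝ) < N := by exact_mod_cast i.pos
  have h1 := (div_lt_div_iff_of_pos_right hN).1 (hi.1.trans_lt hj.2)
  have h2 := (div_lt_div_iff_of_pos_right hN).1 (hj.1.trans_lt hi.2)
  norm_cast at h1 h2
  exact Fin.ext (by omega)

theorem stepVal_of_mem (v : Fin N → E) {i : Fin N} {t : ℝ}
    (hi : t ∈ Set.Ico ((i : ℝ) / N) (((i : ℝ) + 1) / N)) : stepVal v t = v i := by
  rw [stepVal, Finset.sum_eq_single i]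
  · exact Set.indicator_of_mem hi _
  · intro j _ hji
    exact Set.indicator_of_notMem (fun hj => hji (eq_of_mem_Ico_div hj hi)) _
  · simp

theorem stepVal_of_forall_notMem (v : Fin N → E) {t : ℝ}
    (h : ∀ i : Fin N, t ∉ Set.Ico ((i : ℝ) / N) (((i : ℝ) + 1) / N)) : stepVal v t = 0 :=
  Finset.sum_eq_zero fun i _ => Set.indicator_of_notMem (h i) _

theorem exists_mem_Ico_div (hN : 0 < N) {t : ℝ} (ht : t ∈ Set.Ico (0 : ℝ) 1) :
    ∃ i : Fin N, t ∈ Set.Ico ((i : ℝ) / N) (((i : ℝ) + 1) / N) := by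
  have hN' : (0 : ℝ) < N := by exact_mod_cast hN
  have h0 : 0 ≤ t * N := mul_nonneg ht.1 hN'.le
  have hlt : ⌊t * N⌋₊ < N := (Nat.floor_lt h0).2 (by nlinarith [ht.2])
  refine ⟨⟨⌊t * N⌋₊, hlt⟩, ?_, ?_⟩
  · rw [div_le_iff₀ hN']
    exact Nat.floor_le h0
  · rw [lt_div_iff₀ hN']
    exact Nat.lt_floor_add_one _

theorem Ico_div_subset_Icc (i : Fin N) :
    Set.Ico ((i : ℝ) / N) (((i : ℝ) + 1) / N) ⊆ Set.Icc 0 1 := by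
  have hN : (0 : ℝ) < N := by exact_mod_cast i.pos
  intro t ht
  refine ⟨le_trans (by positivity) ht.1, ht.2.le.trans ?_⟩
  rw [div_le_one hN]
  exact_mod_cast i.2

theorem apply_stepVal {F : Type*} [NormedAddCommGroup F] (φ : E → F) (hφ : φ 0 = 0)
    (v : Fin N → E) (t : ℝ) : φ (stepVal v t) = stepVal (fun i => φ (v i)) t := by
  by_cases h : ∃ i : Fin N, t ∈ Set.Ico ((i : ℝ) / N) (((i : ℝ) + 1) / N)
  · obtain ⟨i, hi⟩ := h
    rw [stepVal_of_mem _ hi, stepVal_of_mem _ hi]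
  · push Not at h
    rw [stepVal_of_forall_notMem _ h, stepVal_of_forall_notMem _ h, hφ]

theorem norm_stepVal_le {v : Fin N → E} {C : ℝ} (hC : 0 ≤ C) (h : ∀ i, ‖v i‖ ≤ C) (t : ℝ) :
    ‖stepVal v t‖ ≤ C := by
  by_cases ht : ∃ i : Fin N, t ∈ Set.Ico ((i : ℝ) / N) (((i : ℝ) + 1) / N)
  · obtain ⟨i, hi⟩ := ht
    rw [stepVal_of_mem _ hi]
    exact h i
  · push Not at ht
    rwa [stepVal_of_forall_notMem _ ht, norm_zero]

theorem integrable_stepVal (v : Fin N → E) : Integrable (stepVal v) := by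
  unfold stepVal
  exact integrable_finsetSum _ fun i _ =>
    (integrable_indicator_iff measurableSet_Ico).2 (integrableOn_const (by simp) (by simp))

theorem integral_stepVal [NormedSpace ℝ E] [CompleteSpace E] (v : Fin N → E) :
    ∫ t in Set.Icc 0 1, stepVal v t = (N : ℝ)⁻¹ • ∑ i, v i := by
  unfold stepVal
  have hint : ∀ i : Fin N, Integrable
      (fun t => (Set.Ico ((i : ℝ) / N) (((i : ℝ) + 1) / N)).indicator (fun _ => v i) t)
      (volume.restrict (Set.Icc 0 1)) := fun i =>
    ((integrable_indicator_iff measurableSet_Ico).2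
      (integrableOn_const (by simp) (by simp))).mono_measure Measure.restrict_le_self
  rw [integral_finsetSum _ fun i _ => hint i, Finset.smul_sum]
  refine Finset.sum_congr rfl fun i _ => ?_
  have hN : (0 : ℝ) < N := by exact_mod_cast i.pos
  rw [integral_indicator measurableSet_Ico, Measure.restrict_restrict measurableSet_Ico,
    Set.inter_eq_left.2 (Ico_div_subset_Icc i), setIntegral_const, Real.volume_real_Ico_of_le]
  · congr 1
    field_simp
    ring
  · gcongr
    linarith

end StepVal

variable {n : ℕ} (K : ClosedSubgroup (O n)) (B : InnerProductSpace.Core ℝ (lieAlg K))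

/-! ### Norms of step functions -/

section StepFunctions

variable {N M : ℕ}

theorem stepFun_ae_eq (v : Fin N → LieAlg K B) :
    stepFun K B N v =ᵐ[volume.restrict (Set.Icc 0 1)] stepVal v := by
  have h1 := Lp.coeFn_finsetSum (Finset.univ : Finset (Fin N)) fun i : Fin N =>
    indicatorConstLp 2 (μ := volume.restrict (Set.Icc (0 : ℝ) 1))
      (measurableSet_Ico (a := (i : ℝ) / N) (b := ((i : ℝ) + 1) / N)) (measure_ne_top _ _) (v i)
  have h2 : ∀ i : Fin N, ∀ᵐ t ∂(volume.restrict (Set.Icc (0 : ℝ) 1)),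
      indicatorConstLp 2 (μ := volume.restrict (Set.Icc (0 : ℝ) 1))
      (measurableSet_Ico (a := (i : ℝ) / N) (b := ((i : ℝ) + 1) / N)) (measure_ne_top _ _)
        (v i) t = (Set.Ico ((i : ℝ) / N) (((i : ℝ) + 1) / N)).indicator (fun _ => v i) t :=
    fun i => indicatorConstLp_coeFn
  filter_upwards [h1, ae_all_iff.2 h2] with t ht1 ht2
  refine ht1.trans ?_
  rw [Finset.sum_apply]
  exact Finset.sum_congr rfl fun i _ => ht2 i

theorem norm_sq_eq_integral (f : L2 K B) :
    ‖f‖ ^ 2 = ∫ t in Set.Icc (0 : ℝ) 1, ‖f t‖ ^ 2 := by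
  rw [← real_inner_self_eq_norm_sq, L2.inner_def]
  simp only [real_inner_self_eq_norm_sq]

/-- The factor `1/N`, the length of an interval, is the source of the radius `√N R` in coordinates.
-/
theorem norm_stepFun_sq (v : Fin N → LieAlg K B) :
    ‖stepFun K B N v‖ ^ 2 = (N : ℝ)⁻¹ * ∑ i, ‖v i‖ ^ 2 := by
  rw [norm_sq_eq_integral, ← smul_eq_mul, ← integral_stepVal]
  refine integral_congr_ae ?_
  filter_upwards [stepFun_ae_eq K B v] with t ht
  rw [ht]
  exact apply_stepVal (fun X => ‖X‖ ^ 2) (by simp) v t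

theorem integral_norm_le_norm (f : L2 K B) : ∫ t in Set.Icc (0 : ℝ) 1, ‖f t‖ ≤ ‖f‖ := by
  have : IsProbabilityMeasure (volume.restrict (Set.Icc (0 : ℝ) 1)) := ⟨by simp⟩
  rw [integral_norm_eq_lintegral_enorm (Lp.aestronglyMeasurable f), Lp.norm_def,
    ← eLpNorm_one_eq_lintegral_enorm]
  exact ENNReal.toReal_mono (Lp.eLpNorm_ne_top f)
    (eLpNorm_le_eLpNorm_of_exponent_le (by norm_num) (Lp.aestronglyMeasurable f))

theorem ae_mem_Ico : ∀ᵐ t ∂(volume.restrict (Set.Icc (0 : ℝ) 1)), t ∈ Set.Ico (0 : ℝ) 1 := by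
  rw [← restrict_Ico_eq_restrict_Icc]
  exact ae_restrict_mem measurableSet_Ico

/-- Every step function has a positive number of steps. -/
theorem exists_pos_steps (v : Fin N → LieAlg K B) :
    ∃ (m : ℕ) (a : Fin m → LieAlg K B), 0 < m ∧ stepFun K B m a = stepFun K B N v ∧
      stepVal a = stepVal v ∧ stepProd K B a = stepProd K B v := by
  rcases Nat.eq_zero_or_pos N with rfl | h
  · refine ⟨1, 0, one_pos, ?_, ?_, ?_⟩
    · rw [map_zero, Subsingleton.elim v 0, map_zero]
    · funext t
      simp [stepVal]
    · funext t
      have h0 : stepProd K B v t = 1 := prod_reverse_ofFn_eq_one fun i => i.elim0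
      rw [h0]
      refine prod_reverse_ofFn_eq_one fun i => ?_
      rw [Pi.zero_apply, smul_zero]
      exact expK_zero
  · exact ⟨N, v, h, rfl, rfl, rfl⟩

end StepFunctions

/-! ### Lipschitz dependence of the product integral on the step function -/

section Comparison

variable {N M : ℕ}

/-- On an interval inside one cell of each partition both products only gain a left exponential
factor. The old difference passes through unamplified, and the two new factors differ by at most `2
C (t - s) ‖v i - w j‖`, which is the integral term. -/
theorem norm_mat_stepProd_sub_le_add {C : ℝ} (hC : ∀ X, ‖lieMat K B X‖ ≤ C * ‖X‖)
    (v : Fin N → LieAlg K B) (w : Fin M → LieAlg K B) (i : Fin N) (j : Fin M) {s t : ℝ}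
    (hi : (i : ℝ) / N ≤ s) (hj : (j : ℝ) / M ≤ s) (hst : s ≤ t) (hi' : t ≤ ((i : ℝ) + 1) / N)
    (hj' : t ≤ ((j : ℝ) + 1) / M) :
    ‖mat (stepProd K B v t) - mat (stepProd K B w t)‖ ≤
      ‖mat (stepProd K B v s) - mat (stepProd K B w s)‖ +
        2 * C * ∫ x in Set.Ico s t, ‖stepVal v x - stepVal w x‖ := by
  have hint : ∫ x in Set.Ico s t, ‖stepVal v x - stepVal w x‖ = (t - s) * ‖v i - w j‖ := by
    have h1 : ∀ x ∈ Set.Ico s t, ‖stepVal v x - stepVal w x‖ = ‖v i - w j‖ := fun x hx => by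
      rw [stepVal_of_mem v ⟨hi.trans hx.1, hx.2.trans_le hi'⟩,
        stepVal_of_mem w ⟨hj.trans hx.1, hx.2.trans_le hj'⟩]
    rw [setIntegral_congr_fun measurableSet_Ico h1, setIntegral_const,
      Real.volume_real_Ico_of_le hst, smul_eq_mul]
  rw [hint, stepProd_eq_mul B v i hi hst hi', stepProd_eq_mul B w j hj hst hj', mat_mul, mat_mul]
  set e := expK K ((t - s) • v i : LieAlg K B) with he
  set e' := expK K ((t - s) • w j : LieAlg K B) with he'
  set a := stepProd K B v s
  set b := stepProd K B w s
  have hsplit : mat e * mat a - mat e' * mat b =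
      mat e * (mat a - mat b) + (mat e - mat e') * mat b := by noncomm_ring
  have hexp : ‖mat e - mat e'‖ ≤ 2 * ‖lieMat K B ((t - s) • (v i - w j))‖ := by
    rw [smul_sub, map_sub]
    exact norm_mat_expK_sub_le _ _
  rw [hsplit]
  refine (norm_add_le _ _).trans ?_
  rw [norm_mat_mul, norm_mul_mat]
  refine add_le_add le_rfl (hexp.trans ?_)
  have := hC ((t - s) • (v i - w j))
  rw [norm_smul, Real.norm_of_nonneg (sub_nonneg.2 hst)] at this
  linarith

/-- Sum the one-cell estimate over the common refinement into `N * M` cells. The constant does not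
depend on `N` and `M`, as the extension by continuity needs. -/
theorem norm_mat_stepProd_sub_le_integral {C : ℝ} (hC : ∀ X, ‖lieMat K B X‖ ≤ C * ‖X‖)
    (hN : 0 < N) (hM : 0 < M) (v : Fin N → LieAlg K B) (w : Fin M → LieAlg K B) {t : ℝ}
    (ht : t ∈ Set.Icc (0 : ℝ) 1) :
    ‖mat (stepProd K B v t) - mat (stepProd K B w t)‖ ≤
      2 * C * ∫ x in Set.Ico 0 t, ‖stepVal v x - stepVal w x‖ := by
  have hN' : (0 : ℝ) < N := by exact_mod_cast hN
  have hM' : (0 : ℝ) < M := by exact_mod_cast hM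
  have hint : Integrable fun x => ‖stepVal v x - stepVal w x‖ :=
    ((integrable_stepVal v).sub (integrable_stepVal w)).norm
  -- Cell `k` of the partition into `a * b` intervals lies in cell `⌊k / b⌋` of the partition into
  -- `a`.
  have cell : ∀ {a b k : ℕ}, 0 < a → 0 < b → k < a * b → k / b < a ∧
      (((k / b : ℕ) : ℝ) / a ≤ (k : ℝ) / (a * b)) ∧
      (((k : ℝ) + 1) / (a * b) ≤ (((k / b : ℕ) : ℝ) + 1) / a) := by
    intro a b k ha hb hk
    have ha' : (0 : ℝ) < a := by exact_mod_cast ha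
    have hb' : (0 : ℝ) < b := by exact_mod_cast hb
    refine ⟨Nat.div_lt_of_lt_mul (by rwa [mul_comm] at hk), ?_, ?_⟩
    · rw [div_le_div_iff₀ ha' (by positivity)]
      have h : ((k / b : ℕ) : ℝ) * b ≤ k := by exact_mod_cast Nat.div_mul_le_self k b
      nlinarith
    · rw [div_le_div_iff₀ (by positivity) ha']
      have h : (k : ℝ) + 1 ≤ (((k / b : ℕ) : ℝ) + 1) * b := by
        exact_mod_cast Nat.lt_div_mul_add hb |>.trans_eq (by ring)
      nlinarith
  have key : ∀ k ≤ N * M, ∀ t : ℝ, 0 ≤ t → t ≤ (k : ℝ) / (N * M) →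
      ‖mat (stepProd K B v t) - mat (stepProd K B w t)‖ ≤
      2 * C * ∫ x in Set.Ico 0 t, ‖stepVal v x - stepVal w x‖ := by
    intro k
    induction k with
    | zero =>
      intro _ t h0 h1
      obtain rfl : t = 0 := le_antisymm (by simpa using h1) h0
      simp [stepProd_zero]
    | succ k ih =>
      intro hk t h0 h1
      by_cases hle : t ≤ (k : ℝ) / (N * M)
      · exact ih (by omega) t h0 hle
      · push Not at hle
        obtain ⟨ci, ci1, ci2⟩ := cell hN hM (Nat.lt_of_succ_le hk)
        obtain ⟨cj, cj1, cj2⟩ := cell hM hN (by rw [mul_comm]; exact Nat.lt_of_succ_le hk)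
        rw [mul_comm (M : ℝ)] at cj1 cj2
        push_cast at h1
        have hs0 : (0 : ℝ) ≤ (k : ℝ) / (N * M) := by positivity
        have hloc := norm_mat_stepProd_sub_le_add K B hC v w ⟨k / M, ci⟩ ⟨k / N, cj⟩ ci1 cj1
          hle.le (h1.trans ci2) (h1.trans cj2)
        refine hloc.trans ?_
        have hsplit : ∫ x in Set.Ico 0 t, ‖stepVal v x - stepVal w x‖ =
            (∫ x in Set.Ico 0 ((k : ℝ) / (N * M)), ‖stepVal v x - stepVal w x‖) +
              ∫ x in Set.Ico ((k : ℝ) / (N * M)) t, ‖stepVal v x - stepVal w x‖ := by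
          rw [← setIntegral_union _ measurableSet_Ico hint.integrableOn hint.integrableOn,
            Set.Ico_union_Ico_eq_Ico hs0 hle.le]
          exact Set.disjoint_left.2 fun x hx hx' => (hx.2.trans_le hx'.1).false
        rw [hsplit, mul_add]
        exact add_le_add (ih (by omega) _ hs0 le_rfl) le_rfl
  refine key (N * M) le_rfl t ht.1 ?_
  push_cast
  rw [div_self (by positivity)]
  exact ht.2

/-- The product integral of step functions is Lipschitz for the `L²` norm. -/
theorem exists_norm_mat_stepProd_sub_le :
    ∃ C > 0, ∀ (N M : ℕ) (v : Fin N → LieAlg K B) (w : Fin M → LieAlg K B),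
      ∀ t ∈ Set.Icc (0 : ℝ) 1, ‖mat (stepProd K B v t) - mat (stepProd K B w t)‖ ≤
        C * ‖stepFun K B N v - stepFun K B M w‖ := by
  obtain ⟨C, hC, h⟩ := exists_norm_lieMat_le K B
  refine ⟨2 * C, by positivity, fun N M v w t ht => ?_⟩
  obtain ⟨N', v', hN', hv1, hv2, hv3⟩ := exists_pos_steps K B v
  obtain ⟨M', w', hM', hw1, hw2, hw3⟩ := exists_pos_steps K B w
  rw [← hv1, ← hw1, ← hv3, ← hw3]
  refine (norm_mat_stepProd_sub_le_integral K B h hN' hM' v' w' ht).trans ?_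
  gcongr
  have hint : Integrable fun x => ‖stepVal v' x - stepVal w' x‖ :=
    ((integrable_stepVal v').sub (integrable_stepVal w')).norm
  refine le_trans ?_ (integral_norm_le_norm K B _)
  calc ∫ x in Set.Ico 0 t, ‖stepVal v' x - stepVal w' x‖
      ≤ ∫ x in Set.Icc 0 1, ‖stepVal v' x - stepVal w' x‖ :=
        setIntegral_mono_set hint.integrableOn (Eventually.of_forall fun x => norm_nonneg _)
          (LE.le.eventuallyLE fun x hx => ⟨hx.1, hx.2.le.trans ht.2⟩)
    _ = ∫ x in Set.Icc 0 1, ‖(stepFun K B N' v' - stepFun K B M' w') x‖ := by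
        refine integral_congr_ae ?_
        filter_upwards [stepFun_ae_eq K B v', stepFun_ae_eq K B w',
          Lp.coeFn_sub (stepFun K B N' v') (stepFun K B M' w')] with x h1 h2 h3
        rw [h3, Pi.sub_apply, h1, h2]

/-- The limit defining `prodExp` runs over step functions with any number of steps; the Lipschitz
bound, uniform in that number, makes it converge to the expected value. -/
theorem prodExp_stepFun (v : Fin N → LieAlg K B) {t : ℝ} (ht : t ∈ Set.Icc (0 : ℝ) 1) :
    prodExp K B (stepFun K B N v) t = stepProd K B v t := by
  obtain ⟨C, hC, h⟩ := exists_norm_mat_stepProd_sub_le K B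
  have hne : (comap (fun p : (N : ℕ) × (Fin N → LieAlg K B) => stepFun K B p.1 p.2)
      (𝓝 (stepFun K B N v))).NeBot :=
    comap_neBot fun s hs => ⟨⟨N, v⟩, mem_of_mem_nhds hs⟩
  refine Tendsto.limUnder_eq ?_
  rw [isInducing_mat.tendsto_nhds_iff, tendsto_iff_norm_sub_tendsto_zero]
  refine squeeze_zero (fun _ => norm_nonneg _) (fun p => h p.1 N p.2 v t ht) ?_
  have h1 := tendsto_iff_norm_sub_tendsto_zero.1 (tendsto_comap (f := fun p : (N : ℕ) ×
    (Fin N → LieAlg K B) => stepFun K B p.1 p.2) (x := 𝓝 (stepFun K B N v)))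
  simpa using h1.const_mul C

end Comparison

end PathGroup

namespace PathGroup

open scoped Matrix.Norms.L2Operator

variable {n : ℕ} (K : ClosedSubgroup (O n)) (B : InnerProductSpace.Core ℝ (lieAlg K))

instance : MeasurableSpace (LieAlg K B) := borel _

instance : BorelSpace (LieAlg K B) := ⟨rfl⟩

/-! ### The right translation on step functions -/

section GroupLaw

variable {K B} {N : ℕ}

theorem memLp_AdB_stepProd
    (hB : ∀ (k : K) (X Y : lieAlg K), B.inner (Ad K k X) (Ad K k Y) = B.inner X Y)
    (v : Fin N → LieAlg K B) (g : L2 K B) :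
    MemLp (fun t => AdB K B (stepProd K B v t) (g t)) 2 (volume.restrict (Set.Icc (0 : ℝ) 1)) := by
  refine (memLp_congr_norm ?_ (Lp.aestronglyMeasurable g) ?_).2 (Lp.memLp g)
  · have hv : Continuous fun t : ℝ => (v, t) := Continuous.prodMk_right v
    have hu := (continuous_stepProd (K := K) (N := N) B).comp hv
    have : TopologicalSpace.PseudoMetrizableSpace K := isInducing_mat.pseudoMetrizableSpace
    have h1 : AEStronglyMeasurable (fun t => stepProd K B v t)
        (volume.restrict (Set.Icc (0 : ℝ) 1)) := hu.aestronglyMeasurable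
    have h2 : AEStronglyMeasurable (fun t => (stepProd K B v t, g t))
        (volume.restrict (Set.Icc (0 : ℝ) 1)) := h1.prodMk (Lp.aestronglyMeasurable g)
    have h3 := (continuous_AdB K B).comp_aestronglyMeasurable h2
    exact h3
  · exact Eventually.of_forall fun t => norm_AdB K B hB _ _

/-- The function `Ad_{∏ exp v} g` for a step function `v`. -/
def adLp (hB : ∀ (k : K) (X Y : lieAlg K), B.inner (Ad K k X) (Ad K k Y) = B.inner X Y)
    (v : Fin N → LieAlg K B) (g : L2 K B) : L2 K B :=
  (memLp_AdB_stepProd hB v g).toLp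

variable (hB : ∀ (k : K) (X Y : lieAlg K), B.inner (Ad K k X) (Ad K k Y) = B.inner X Y)

theorem adLp_ae_eq (v : Fin N → LieAlg K B) (g : L2 K B) :
    adLp hB v g =ᵐ[volume.restrict (Set.Icc 0 1)]
      fun t => AdB K B (stepProd K B v t) (g t) :=
  MemLp.coeFn_toLp _

theorem pathMul_stepFun (v : Fin N → LieAlg K B) (g : L2 K B) :
    pathMul K B (stepFun K B N v) g = stepFun K B N v + adLp hB v g := by
  have hae : AdFun K B (prodExp K B (stepFun K B N v)) g =ᵐ[volume.restrict (Set.Icc 0 1)]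
      fun t => AdB K B (stepProd K B v t) (g t) := by
    filter_upwards [ae_restrict_mem measurableSet_Icc] with t ht
    rw [AdFun, prodExp_stepFun K B v ht]
    rfl
  have hm := (memLp_AdB_stepProd hB v g).ae_eq hae.symm
  rw [pathMul, dif_pos hm]
  congr 1
  exact MemLp.toLp_congr _ _ hae

/-- Pointwise `Ad` is isometric by invariance of `B`, so replacing `g` by its samples costs only
their distance, whatever `v` is. -/
theorem norm_adLp_sub_adLp_le (v : Fin N → LieAlg K B) (g g' : L2 K B) :
    ‖adLp hB v g - adLp hB v g'‖ ≤ ‖g - g'‖ := by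
  refine Lp.norm_le_norm_of_ae_le ?_
  filter_upwards [Lp.coeFn_sub (adLp hB v g) (adLp hB v g'), Lp.coeFn_sub g g',
    adLp_ae_eq hB v g, adLp_ae_eq hB v g'] with t h1 h2 h3 h4
  rw [h1, h2, Pi.sub_apply, Pi.sub_apply, h3, h4, ← map_sub, norm_AdB K B hB]

theorem continuous_adLp (g : L2 K B) :
    Continuous fun v : Fin N → LieAlg K B => adLp hB v g := by
  obtain ⟨C₁, hC₁, h₁⟩ := exists_norm_AdB_sub_le K B
  obtain ⟨C₂, hC₂, h₂⟩ := exists_norm_mat_stepProd_sub_le K B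
  have hlip : ∀ v w : Fin N → LieAlg K B, ‖adLp hB v g - adLp hB w g‖ ≤
      C₁ * (C₂ * ‖stepFun K B N v - stepFun K B N w‖) * ‖g‖ := by
    intro v w
    refine Lp.norm_le_mul_norm_of_ae_le_mul ?_
    filter_upwards [Lp.coeFn_sub (adLp hB v g) (adLp hB w g), adLp_ae_eq hB v g,
      adLp_ae_eq hB w g, ae_restrict_mem measurableSet_Icc] with t e1 e2 e3 ht
    rw [e1, Pi.sub_apply, e2, e3]
    refine (h₁ _ _ _).trans ?_
    gcongr
    exact h₂ N N v w t ht
  have hJ : Continuous (stepFun K B N) := LinearMap.continuous_of_finiteDimensional _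
  refine continuous_iff_continuousAt.2 fun w => ?_
  refine tendsto_iff_norm_sub_tendsto_zero.2
    (squeeze_zero (fun _ => norm_nonneg _) (fun v => hlip v w) ?_)
  have : Continuous fun v : Fin N → LieAlg K B =>
      C₁ * (C₂ * ‖stepFun K B N v - stepFun K B N w‖) * ‖g‖ := by fun_prop
  simpa using this.tendsto w

/-- Freezing the product integral at the left end of each interval of the partition. -/
theorem exists_norm_adLp_sub_stepFun_le :
    ∃ C > 0, ∀ (N : ℕ) (v γ : Fin N → LieAlg K B) (M : ℝ), (∀ i, ‖γ i‖ ≤ M) → 0 < N →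
      ‖adLp hB v (stepFun K B N γ) -
        stepFun K B N (fun i => AdB K B (stepProd K B v ((i : ℝ) / N)) (γ i))‖ ≤
      C * M / N * ‖stepFun K B N v‖ := by
  obtain ⟨C₁, hC₁, h₁⟩ := exists_norm_AdB_sub_le K B
  obtain ⟨C₂, hC₂, h₂⟩ := exists_norm_lieMat_le K B
  refine ⟨C₁ * (2 * C₂), by positivity, fun N v γ M hM hN => ?_⟩
  have hN' : (0 : ℝ) < N := by exact_mod_cast hN
  refine Lp.norm_le_mul_norm_of_ae_le_mul ?_
  set γ' : Fin N → LieAlg K B := fun i => AdB K B (stepProd K B v ((i : ℝ) / N)) (γ i)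
  filter_upwards [Lp.coeFn_sub (adLp hB v (stepFun K B N γ)) (stepFun K B N γ'),
    adLp_ae_eq hB v (stepFun K B N γ), stepFun_ae_eq K B γ, stepFun_ae_eq K B γ',
    stepFun_ae_eq K B v, ae_mem_Ico] with t e1 e2 e3 e4 e5 ht
  obtain ⟨i, hi⟩ := exists_mem_Ico_div hN ht
  rw [e1, Pi.sub_apply, e2, e3, e4, e5, stepVal_of_mem _ hi, stepVal_of_mem _ hi,
    stepVal_of_mem _ hi]
  refine (h₁ _ _ _).trans ?_
  have hti : t - (i : ℝ) / N ≤ 1 / N := by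
    have := hi.2
    rw [add_div] at this
    linarith
  -- Since `i/N` the product has gained one factor, the exponential of `v i` over a time of at most
  -- `1/N`. Being linear in `‖v i‖`, the bound integrates to `‖stepFun K B N v‖`.
  have hstep : ‖mat (stepProd K B v t) - mat (stepProd K B v ((i : ℝ) / N))‖ ≤
      2 * C₂ * (1 / N * ‖v i‖) := by
    rw [stepProd_eq_mul B v i le_rfl hi.1 hi.2.le, mat_mul]
    set e := expK K ((t - (i : ℝ) / N) • v i : LieAlg K B)
    set b := stepProd K B v ((i : ℝ) / N)
    have hs : mat e * mat b - mat b = (mat e - 1) * mat b := by noncomm_ring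
    rw [hs, norm_mul_mat]
    have h3 : ‖mat e - 1‖ ≤ 2 * ‖lieMat K B ((t - (i : ℝ) / N) • v i)‖ :=
      norm_mat_expK_sub_one_le _
    have h4 := h₂ ((t - (i : ℝ) / N) • v i)
    rw [norm_smul, Real.norm_of_nonneg (sub_nonneg.2 hi.1)] at h4
    have h5 : (t - (i : ℝ) / N) * ‖v i‖ ≤ 1 / N * ‖v i‖ := by gcongr
    calc ‖mat e - 1‖ ≤ 2 * (C₂ * ((t - (i : ℝ) / N) * ‖v i‖)) := h3.trans (by linarith)
      _ ≤ 2 * (C₂ * (1 / N * ‖v i‖)) := by gcongr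
      _ = _ := by ring
  calc C₁ * ‖mat (stepProd K B v t) - mat (stepProd K B v ((i : ℝ) / N))‖ * ‖γ i‖
      ≤ C₁ * (2 * C₂ * (1 / N * ‖v i‖)) * M := by
        gcongr
        exact hM i
    _ = _ := by ring

end GroupLaw

/-! ### Approximation of a fixed step function by its samples -/

section Sampling

variable {m : ℕ}

/-- Step functions are limits of their samples at the points `i/N`. -/
theorem tendsto_stepFun_sample (hm : 0 < m) (a : Fin m → LieAlg K B) :
    Tendsto (fun N : ℕ => ‖stepFun K B N (fun i => stepVal a ((i : ℝ) / N)) - stepFun K B m a‖)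
      atTop (𝓝 0) := by
  have hm' : (0 : ℝ) < m := by exact_mod_cast hm
  set γ : (N : ℕ) → Fin N → LieAlg K B := fun N i => stepVal a ((i : ℝ) / N) with hγ
  set M : ℝ := ∑ j, ‖a j‖ with hMdef
  have hM0 : 0 ≤ M := Finset.sum_nonneg fun _ _ => norm_nonneg _
  have hM : ∀ t, ‖stepVal a t‖ ≤ M := fun t => norm_stepVal_le hM0
    (fun j => Finset.single_le_sum (f := fun j => ‖a j‖) (fun _ _ => norm_nonneg _)
      (Finset.mem_univ j)) t
  have hγM : ∀ N t, ‖stepVal (γ N) t‖ ≤ M := fun N t => norm_stepVal_le hM0 (fun i => hM _) t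
  have hae : ∀ N, (fun t => ‖(stepFun K B N (γ N) - stepFun K B m a) t‖ ^ 2)
      =ᵐ[volume.restrict (Set.Icc 0 1)] fun t => ‖stepVal (γ N) t - stepVal a t‖ ^ 2 := by
    intro N
    filter_upwards [Lp.coeFn_sub (stepFun K B N (γ N)) (stepFun K B m a),
      stepFun_ae_eq K B (γ N), stepFun_ae_eq K B a] with t h1 h2 h3
    rw [h1, Pi.sub_apply, h2, h3]
  have hlim : Tendsto (fun N : ℕ => ∫ t in Set.Icc (0 : ℝ) 1, ‖stepVal (γ N) t - stepVal a t‖ ^ 2)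
      atTop (𝓝 (∫ _t in Set.Icc (0 : ℝ) 1, (0 : ℝ))) := by
    refine tendsto_integral_of_dominated_convergence (fun _ => (2 * M) ^ 2) ?_
      (integrable_const _) ?_ ?_
    · intro N
      exact (((integrable_stepVal (γ N)).sub (integrable_stepVal a)).aestronglyMeasurable.norm.pow
        2).mono_measure Measure.restrict_le_self
    · intro N
      refine Eventually.of_forall fun t => ?_
      rw [Real.norm_of_nonneg (by positivity)]
      gcongr
      refine (norm_sub_le _ _).trans ?_
      linarith [hM t, hγM N t]
    -- Jump points are excluded: the sample is taken to the left of `t`, and at a jump it could fall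
    -- in the preceding step. Elsewhere it eventually equals the value at `t`.
    · have hne : ∀ᵐ t ∂(volume.restrict (Set.Icc (0 : ℝ) 1)), ∀ j : Fin m, t ≠ (j : ℝ) / m :=
        ae_all_iff.2 fun j => Measure.ae_ne _ _
      filter_upwards [hne, ae_mem_Ico] with t ht ht1
      obtain ⟨j, hj⟩ := exists_mem_Ico_div hm ht1
      have hpos : 0 < t - (j : ℝ) / m := sub_pos.2 (lt_of_le_of_ne hj.1 (ht j).symm)
      refine tendsto_const_nhds.congr' ?_
      filter_upwards [(tendsto_one_div_atTop_nhds_zero_nat (𝕜 := ℝ)).eventually_lt_const hpos,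
        eventually_gt_atTop 0] with N hN hN0
      obtain ⟨i, hi⟩ := exists_mem_Ico_div hN0 ht1
      have h1 : (i : ℝ) / N ∈ Set.Ico ((j : ℝ) / m) (((j : ℝ) + 1) / m) := by
        refine ⟨?_, hi.1.trans_lt hj.2⟩
        have := hi.2
        rw [add_div] at this
        linarith
      rw [stepVal_of_mem (γ N) hi, stepVal_of_mem a hj, hγ]
      dsimp only
      rw [stepVal_of_mem a h1]
      simp
  have hsq : Tendsto (fun N : ℕ => ‖stepFun K B N (γ N) - stepFun K B m a‖ ^ 2) atTop (𝓝 0) := by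
    simp only [norm_sq_eq_integral]
    simpa only [integral_congr_ae (hae _), integral_zero] using hlim
  simpa [Real.sqrt_sq] using hsq.sqrt

end Sampling

/-! ### The uniform measure on the ball in coordinates -/

section UniformMeasure

variable {N : ℕ}

theorem stepFun_injective (hN : 0 < N) : Function.Injective (stepFun K B N) := by
  refine (injective_iff_map_eq_zero _).2 fun v hv => ?_
  have h := norm_stepFun_sq K B v
  rw [hv, norm_zero, zero_pow two_ne_zero, eq_comm, mul_eq_zero,
    Finset.sum_eq_zero_iff_of_nonneg fun _ _ => by positivity] at h
  have hN' : (N : ℝ)⁻¹ ≠ 0 := by positivity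
  funext i
  simpa using h.resolve_left hN' i (Finset.mem_univ i)

theorem norm_stepFun_le_iff (hN : 0 < N) {R : ℝ} (hR : 0 ≤ R) (v : Fin N → LieAlg K B) :
    ‖stepFun K B N v‖ ≤ R ↔ v ∈ pBall (LieAlg K B) N (Real.sqrt N * R) := by
  have hN' : (0 : ℝ) < N := by exact_mod_cast hN
  rw [← sq_le_sq₀ (norm_nonneg _) hR, norm_stepFun_sq, inv_mul_le_iff₀ hN', pBall,
    Set.mem_ofPred_eq, mul_pow, Real.sq_sqrt hN'.le]

theorem cond_smul_measure {X : Type*} [MeasurableSpace X] (μ : Measure X) {c : ℝ≥0∞} (h0 : c ≠ 0)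
    (ht : c ≠ ⊤) (s : Set X) : ProbabilityTheory.cond (c • μ) s = ProbabilityTheory.cond μ s := by
  rw [ProbabilityTheory.cond, ProbabilityTheory.cond, Measure.restrict_smul, Measure.smul_apply,
    smul_smul, smul_eq_mul, ENNReal.mul_inv (Or.inl h0) (Or.inl ht), mul_right_comm,
    ENNReal.inv_mul_cancel h0 ht, one_mul]

theorem cond_map_measure {X Y : Type*} [MeasurableSpace X] [MeasurableSpace Y] (μ : Measure X)
    {f : X → Y} (hf : Measurable f) {s : Set Y} (hs : MeasurableSet s) :
    ProbabilityTheory.cond (μ.map f) s = (ProbabilityTheory.cond μ (f ⁻¹' s)).map f := by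
  rw [ProbabilityTheory.cond, ProbabilityTheory.cond, Measure.restrict_map hf hs,
    Measure.map_apply hf hs, Measure.map_smul]

/-- The uniform measure on the ball of `V_N` in coordinates. -/
theorem nu_eq_map (hN : 0 < N) {R : ℝ} (hR : 0 ≤ R) :
    nu K B N R = (ProbabilityTheory.cond (volume : Measure (Fin N → LieAlg K B))
      (pBall (LieAlg K B) N (Real.sqrt N * R))).map (stepFun K B N) := by
  let L : (Fin N → LieAlg K B) ≃L[ℝ] stepSpace K B N :=
    (LinearEquiv.ofInjective (stepFun K B N) (stepFun_injective K B hN)).toContinuousLinearEquiv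
  have hL : ∀ v, (L v : L2 K B) = stepFun K B N v := fun v => rfl
  have hLm : Measurable L := L.continuous.measurable
  have hH := L.isAddHaarMeasure_map (volume : Measure (Fin N → LieAlg K B))
  -- By uniqueness of Haar measure the two volumes on `V_N` are proportional, and the factor drops
  -- out on normalizing.
  set c := (volume : Measure (stepSpace K B N)).addHaarScalarFactor
    ((volume : Measure (Fin N → LieAlg K B)).map L)
  have hvol : (volume : Measure (stepSpace K B N)) =
      (c : ℝ≥0∞) • (volume : Measure (Fin N → LieAlg K B)).map L :=
    Measure.isAddLeftInvariant_eq_smul (volume : Measure (stepSpace K B N))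
      ((volume : Measure (Fin N → LieAlg K B)).map L)
  have hc : 0 < c := Measure.addHaarScalarFactor_pos_of_isAddHaarMeasure
    (volume : Measure (stepSpace K B N)) ((volume : Measure (Fin N → LieAlg K B)).map L)
  have hpre : L ⁻¹' Metric.closedBall 0 R = pBall (LieAlg K B) N (Real.sqrt N * R) := by
    ext v
    rw [← norm_stepFun_le_iff K B hN hR, Set.mem_preimage, mem_closedBall_zero_iff, ← hL]
    rfl
  rw [nu, hvol, cond_smul_measure _ (by exact_mod_cast hc.ne')
    ENNReal.coe_ne_top, cond_map_measure _ hLm Metric.isClosed_closedBall.measurableSet, hpre,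
    Measure.map_map measurable_subtype_coe hLm]
  rfl

end UniformMeasure

end PathGroup

/-! ### Asymptotic invariance -/

namespace PathGroup

variable {n : ℕ} {K : ClosedSubgroup (O n)} {B : InnerProductSpace.Core ℝ (lieAlg K)} {N : ℕ}

theorem continuous_AdB_stepProd (γ : LieAlg K B) (t : ℝ) :
    Continuous fun v : Fin N → LieAlg K B => AdB K B (stepProd K B v t) γ := by
  have h1 : Continuous fun v : Fin N → LieAlg K B => (v, t) := Continuous.prodMk_left t
  have h2 := (continuous_stepProd (K := K) (N := N) B).comp h1
  have h3 : Continuous fun v : Fin N → LieAlg K B => (stepProd K B v t, γ) :=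
    h2.prodMk continuous_const
  have h4 := (continuous_AdB K B).comp h3
  exact h4

theorem rightTranslate_nu
    (hB : ∀ (k : K) (X Y : lieAlg K), B.inner (Ad K k X) (Ad K k Y) = B.inner X Y)
    (hN : 0 < N) {R : ℝ} (hR : 0 ≤ R) (g : L2 K B) :
    rightTranslate K B (nu K B N R) g =
      (ProbabilityTheory.cond (volume : Measure (Fin N → LieAlg K B))
        (pBall (LieAlg K B) N (Real.sqrt N * R))).map (fun v => stepFun K B N v + adLp hB v g) := by
  have hemb : MeasurableEmbedding (stepFun K B N) :=
    ((stepFun K B N).isClosedEmbedding_of_injective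
      (LinearMap.ker_eq_bot.2 (stepFun_injective K B hN))).measurableEmbedding
  have hcomp : (fun f => pathMul K B f g) ∘ stepFun K B N =
      fun v => stepFun K B N v + adLp hB v g := funext fun v => pathMul_stepFun hB v g
  have hJ : Continuous (stepFun K B N) := LinearMap.continuous_of_finiteDimensional _
  have hmeas : Measurable fun v : Fin N → LieAlg K B => stepFun K B N v + adLp hB v g :=
    (hJ.add (continuous_adLp hB g)).measurable
  -- Measurability of `f ↦ f ∗ g` on all of `L²` is not needed: the measure lives on the image of
  -- the embedding `stepFun`, and the composite with it is continuous.
  rw [rightTranslate, nu_eq_map K B hN hR, AEMeasurable.map_map_of_aemeasurable _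
    hemb.measurable.aemeasurable, hcomp]
  rw [hemb.aemeasurable_map_iff, hcomp]
  exact hmeas.aemeasurable

/-- A quantitative form of the asymptotic invariance of the uniform measures on balls. -/
theorem exists_mkDist_nu_rightTranslate_le
    (hB : ∀ (k : K) (X Y : lieAlg K), B.inner (Ad K k X) (Ad K k Y) = B.inner X Y) :
    ∃ C > 0, ∀ (N : ℕ) (R η M : ℝ) (g : L2 K B) (γ : Fin N → LieAlg K B), 0 < N → 0 < R →
      0 < η → η < 1 → (∀ i, ‖γ i‖ ≤ M) → 2 * M ^ 2 ≤ R ^ 2 * η →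
      mkDist (nu K B N R) (rightTranslate K B (nu K B N R) g) ≤
        ENNReal.ofReal (‖stepFun K B N γ - g‖ + C * M / N * R) +
        ENNReal.ofReal (N * Module.finrank ℝ (LieAlg K B) * η +
          16 * M ^ 2 / (N * R ^ 2 * η ^ 2)) := by
  obtain ⟨C, hC, hfreeze⟩ := exists_norm_adLp_sub_stepFun_le hB
  refine ⟨C, hC, fun N R η M g γ hN hR hη hη1 hM hMR => ?_⟩
  have hN' : (0 : ℝ) < N := by exact_mod_cast hN
  have hM0 : 0 ≤ M := (norm_nonneg _).trans (hM ⟨0, hN⟩)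
  set A := pBall (LieAlg K B) N (Real.sqrt N * R) with hAdef
  have hr : 0 < Real.sqrt N * R := by positivity
  have hr2 : (Real.sqrt N * R) ^ 2 = N * R ^ 2 := by rw [mul_pow, Real.sq_sqrt hN'.le]
  have hmA : MeasurableSet A := (isClosed_pBall _).measurableSet
  have hA0 : volume A ≠ 0 := (volume_pBall_pos hr).ne'
  have hAt : volume A ≠ ⊤ := volume_pBall_ne_top _
  set h : Fin N → (Fin N → LieAlg K B) → LieAlg K B :=
    fun i v => AdB K B (stepProd K B v ((i : ℝ) / N)) (γ i) with hh
  have hc : ∀ i, Continuous (h i) := fun i => continuous_AdB_stepProd _ _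
  have hdep : ∀ i v w, (∀ j < i, v j = w j) → h i v = h i w := fun i v w hvw => by
    simp only [hh, stepProd_congr B i hvw]
  have hhM : ∀ i v, ‖h i v‖ ≤ M := fun i v => by
    rw [hh]
    exact (norm_AdB K B hB _ _).trans_le (hM i)
  set T : (Fin N → LieAlg K B) → (Fin N → LieAlg K B) := fun v i => v i + h i v with hTdef
  have hT : MeasurePreserving T volume volume :=
    measurePreserving_triangular (fun i => (hc i).measurable) hdep
  have hJ : Continuous (stepFun K B N) := LinearMap.continuous_of_finiteDimensional _
  have : IsProbabilityMeasure
      (ProbabilityTheory.cond (volume : Measure (Fin N → LieAlg K B)) A) :=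
    ProbabilityTheory.cond_isProbabilityMeasure_of_finite hA0 hAt
  rw [rightTranslate_nu hB hN hR.le, nu_eq_map K B hN hR.le]
  refine (mkDist_map_le hT.measurable hJ.measurable (hJ.add (continuous_adLp hB g)).measurable
    (hmA.inter (hT.measurable hmA)) (map_restrict_cond_le hT hmA)
    (ε := ‖stepFun K B N γ - g‖ + C * M / N * R) ?_).trans ?_
  · rintro v ⟨hv, -⟩
    have hvR : ‖stepFun K B N v‖ ≤ R := (norm_stepFun_le_iff K B hN hR.le v).2 hv
    have hTv : stepFun K B N (T v) = stepFun K B N v + stepFun K B N (fun i => h i v) := by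
      rw [← map_add]
      rfl
    rw [dist_comm, dist_eq_norm, hTv, Pi.add_apply, add_sub_add_left_eq_sub]
    calc ‖adLp hB v g - stepFun K B N (fun i => h i v)‖
        ≤ ‖adLp hB v g - adLp hB v (stepFun K B N γ)‖ +
          ‖adLp hB v (stepFun K B N γ) - stepFun K B N (fun i => h i v)‖ :=
          norm_sub_le_norm_sub_add_norm_sub _ _ _
      _ ≤ ‖g - stepFun K B N γ‖ + C * M / N * ‖stepFun K B N v‖ :=
          add_le_add (norm_adLp_sub_adLp_le hB v _ _) (hfreeze N v γ M hM hN)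
      _ ≤ ‖stepFun K B N γ - g‖ + C * M / N * R := by
          rw [norm_sub_rev]
          gcongr
  · refine add_le_add le_rfl ?_
    have hesc := volume_pBall_escape_le hc hdep hhM hr hη hη1 (by rw [hr2]; nlinarith)
    rw [hr2, ← hAdef] at hesc
    -- The untransported mass is the fraction of the ball that `T` moves out of it.
    have hset : A ∩ (A ∩ T ⁻¹' A)ᶜ = {v | v ∈ A ∧ (fun i => v i + h i v) ∉ A} := by
      ext v
      simp only [Set.mem_inter_iff, Set.mem_compl_iff, Set.mem_preimage, Set.mem_ofPred_eq]
      tauto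
    have hfin : volume {v | v ∈ A ∧ (fun i => v i + h i v) ∉ A} ≠ ⊤ :=
      measure_ne_top_of_subset (fun v hv => hv.1) hAt
    rw [ProbabilityTheory.cond_apply hmA, hset, mul_comm, ← div_eq_mul_inv]
    refine ENNReal.div_le_of_le_mul ?_
    rw [← ENNReal.ofReal_toReal hfin, ← ENNReal.ofReal_toReal hAt, ← ENNReal.ofReal_mul
      (by positivity)]
    exact ENNReal.ofReal_le_ofReal hesc

theorem tendsto_mkDist_nu_rightTranslate
    (hB : ∀ (k : K) (X Y : lieAlg K), B.inner (Ad K k X) (Ad K k Y) = B.inner X Y)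
    {R : ℕ → ℝ} (hR : ∀ N : ℕ, 1 ≤ N → 0 < R N)
    (hR_sqrt : (fun N : ℕ => Real.sqrt (N : ℝ)) =o[atTop] R)
    (hR_lin : R =o[atTop] (fun N : ℕ => (N : ℝ)))
    {g : L2 K B} (hg : ∃ m : ℕ, g ∈ stepSpace K B m) :
    Tendsto (fun N : ℕ => mkDist (nu K B N (R N)) (rightTranslate K B (nu K B N (R N)) g))
        atTop (𝓝 0) := by
  obtain ⟨m₀, a₀, rfl⟩ := hg
  obtain ⟨m, a, hm, ha, -, -⟩ := exists_pos_steps K B a₀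
  rw [← ha]
  obtain ⟨C, hC, hmain⟩ := exists_mkDist_nu_rightTranslate_le hB
  set M : ℝ := ∑ j, ‖a j‖ with hMdef
  have hM0 : 0 ≤ M := Finset.sum_nonneg fun _ _ => norm_nonneg _
  have hM : ∀ t, ‖stepVal a t‖ ≤ M := fun t => norm_stepVal_le hM0
    (fun j => Finset.single_le_sum (f := fun j => ‖a j‖) (fun _ _ => norm_nonneg _)
      (Finset.mem_univ j)) t
  have hfirst : Tendsto (fun N : ℕ =>
      ‖stepFun K B N (fun i => stepVal a ((i : ℝ) / N)) - stepFun K B m a‖ + C * M / N * R N)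
      atTop (𝓝 0) := by
    have h1 := hR_lin.tendsto_div_nhds_zero.const_mul (C * M)
    have h2 := (tendsto_stepFun_sample K B hm a).add h1
    rw [mul_zero, add_zero] at h2
    refine h2.congr fun N => ?_
    ring
  rw [ENNReal.tendsto_nhds_zero]
  intro ε hε
  -- One `δ` each for the `L²` error, the shell and the Chebyshev term.
  obtain ⟨δ, hδ0, hδ1, hδε⟩ : ∃ δ : ℝ, 0 < δ ∧ δ < 1 ∧ ENNReal.ofReal (3 * δ) ≤ ε := by
    by_cases ht : ε = ⊤
    · exact ⟨1 / 2, by norm_num, by norm_num, by simp [ht]⟩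
    · have hpos : 0 < ε.toReal := ENNReal.toReal_pos hε.ne' ht
      refine ⟨min (1 / 2) (ε.toReal / 3), lt_min (by norm_num) (by positivity),
        (min_le_left _ _).trans_lt (by norm_num), ?_⟩
      refine ENNReal.ofReal_le_of_le_toReal ?_
      linarith [min_le_right (1 / 2) (ε.toReal / 3)]
  set d : ℝ := (Module.finrank ℝ (LieAlg K B) : ℝ) with hd
  have hd0 : 0 ≤ d := Nat.cast_nonneg _
  -- An eventual bound for `N / R_N²`. With `η ≥ δ / ((d + 1) N)` the Chebyshev term is at most `16
  -- M² (d + 1)² x / δ²`, hence at most `δ`; the `+ 1` covers `M = 0`.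
  set x : ℝ := δ ^ 3 / (16 * M ^ 2 * (d + 1) ^ 2 + 1) with hx
  have hx0 : 0 < x := by positivity
  have hxM : x * (16 * M ^ 2 * (d + 1) ^ 2) ≤ δ ^ 3 := by
    have : x * (16 * M ^ 2 * (d + 1) ^ 2 + 1) = δ ^ 3 := div_mul_cancel₀ _ (by positivity)
    linarith
  have hδ3 : δ ^ 3 ≤ δ := by
    have : δ ^ 3 ≤ δ ^ 1 := pow_le_pow_of_le_one hδ0.le hδ1.le (by norm_num)
    simpa using this
  filter_upwards [hfirst.eventually_lt_const hδ0, hR_sqrt.def (Real.sqrt_pos.2 hx0),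
    eventually_ge_atTop 1] with N h1 h2 hN1
  have hN' : (1 : ℝ) ≤ N := by exact_mod_cast hN1
  have hRN := hR N hN1
  have hNR : (N : ℝ) ≤ x * R N ^ 2 := by
    rw [Real.norm_of_nonneg (Real.sqrt_nonneg _), Real.norm_of_nonneg hRN.le] at h2
    have h3 := pow_le_pow_left₀ (Real.sqrt_nonneg _) h2 2
    rwa [mul_pow, Real.sq_sqrt (by positivity), Real.sq_sqrt hx0.le] at h3
  have hD : 0 < N * d + 1 := by positivity
  have hDN : N * d + 1 ≤ (d + 1) * N := by nlinarith
  -- The widest shell, up to the `+ 1` that covers `d = 0`, whose volume fraction `N d η` stays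
  -- below `δ`.
  set η : ℝ := δ / (N * d + 1) with hη
  have hη0 : 0 < η := by positivity
  have hηD : η * (N * d + 1) = δ := div_mul_cancel₀ _ hD.ne'
  have hη1 : η < 1 := by
    rw [hη, div_lt_one hD]
    nlinarith [mul_nonneg (zero_le_one.trans hN') hd0]
  have hM2 : 2 * M ^ 2 ≤ R N ^ 2 * η := by
    rw [hη, ← mul_div_assoc, le_div_iff₀ hD]
    have e1 : 2 * M ^ 2 * (N * d + 1) ≤ 2 * M ^ 2 * ((d + 1) * (x * R N ^ 2)) := by
      gcongr
      exact hDN.trans (by gcongr)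
    have e2 : 2 * M ^ 2 * (d + 1) * x ≤ δ := by
      refine le_trans ?_ (hxM.trans hδ3)
      have : M ^ 2 * (d + 1) * x ≤ M ^ 2 * (d + 1) ^ 2 * x := by
        gcongr
        nlinarith
      have h0 : 0 ≤ M ^ 2 * (d + 1) ^ 2 * x := by positivity
      nlinarith
    nlinarith [sq_nonneg (R N)]
  refine (hmain N (R N) η M (stepFun K B m a) (fun i => stepVal a ((i : ℝ) / N)) hN1 hRN hη0 hη1
    (fun i => hM _) hM2).trans ?_
  rw [← ENNReal.ofReal_add (by positivity) (by positivity)]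
  refine (ENNReal.ofReal_le_ofReal ?_).trans hδε
  have hshell : N * d * η ≤ δ := by nlinarith
  have hcheb : 16 * M ^ 2 / (N * R N ^ 2 * η ^ 2) ≤ δ := by
    rw [div_le_iff₀ (by positivity)]
    have e3 : η * ((d + 1) * N) ≥ δ := by
      rw [← hηD]
      gcongr
    have e4 : δ ^ 2 ≤ η ^ 2 * ((d + 1) ^ 2 * N ^ 2) := by
      calc δ ^ 2 ≤ (η * ((d + 1) * N)) ^ 2 := pow_le_pow_left₀ hδ0.le e3 2
        _ = _ := by ring
    have e5 : 16 * M ^ 2 * (d + 1) ^ 2 * N ≤ δ ^ 3 * R N ^ 2 := by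
      calc 16 * M ^ 2 * (d + 1) ^ 2 * N ≤ 16 * M ^ 2 * (d + 1) ^ 2 * (x * R N ^ 2) := by gcongr
        _ = (x * (16 * M ^ 2 * (d + 1) ^ 2)) * R N ^ 2 := by ring
        _ ≤ δ ^ 3 * R N ^ 2 := by gcongr
    have e6 : 16 * M ^ 2 * ((d + 1) ^ 2 * N) ≤ δ * (N * R N ^ 2 * η ^ 2) * ((d + 1) ^ 2 * N) := by
      calc 16 * M ^ 2 * ((d + 1) ^ 2 * N) = 16 * M ^ 2 * (d + 1) ^ 2 * N := by ring
        _ ≤ δ ^ 3 * R N ^ 2 := e5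
        _ = δ * R N ^ 2 * δ ^ 2 := by ring
        _ ≤ δ * R N ^ 2 * (η ^ 2 * ((d + 1) ^ 2 * N ^ 2)) := by gcongr
        _ = _ := by ring
    exact le_of_mul_le_mul_right e6 (by positivity)
  linarith

end PathGroup

end

open PathGroup
theorem lemma1 {n : ℕ} (K : ClosedSubgroup (O n))
    (B : InnerProductSpace.Core ℝ (lieAlg K))
    (hB : ∀ (k : K) (X Y : lieAlg K), B.inner (Ad K k X) (Ad K k Y) = B.inner X Y)
    (R : ℕ → ℝ) (hR : ∀ N : ℕ, 1 ≤ N → 0 < R N)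
    (hR_sqrt : (fun N : ℕ => Real.sqrt (N : ℝ)) =o[atTop] R)
    (hR_lin : R =o[atTop] (fun N : ℕ => (N : ℝ)))
    (g : L2 K B) (hg : ∃ m : ℕ, g ∈ stepSpace K B m) :
    Tendsto (fun N : ℕ => mkDist (nu K B N (R N)) (rightTranslate K B (nu K B N (R N)) g))
        atTop (𝓝 0) ∧
      ∀ ε : ℝ, 0 < ε → ∃ N₀ : ℕ, ∀ N : ℕ, N₀ ≤ N → ∀ F : L2 K B → ℝ,
        LipschitzWith 1 F → (∀ f, |F f| ≤ 1) →
          |(∫ f, F f ∂(nu K B N (R N))) - ∫ f, F f ∂(rightTranslate K B (nu K B N (R N)) g)| < ε := by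
  have hlim := tendsto_mkDist_nu_rightTranslate hB hR hR_sqrt hR_lin hg
  refine ⟨hlim, fun ε hε => ?_⟩
  -- The test functions lose a factor `2` against the distance, and `2 ε / 3 < ε`.
  have hev := hlim.eventually_lt_const
    (ENNReal.ofReal_pos.2 (by positivity : (0 : ℝ) < ε / 3))
  obtain ⟨N₀, hN₀⟩ := eventually_atTop.1 hev
  refine ⟨N₀, fun N hN F hF hb => ?_⟩
  have : IsFiniteMeasure (nu K B N (R N)) := by
    unfold nu
    infer_instance
  have : IsFiniteMeasure (rightTranslate K B (nu K B N (R N)) g) := by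
    unfold rightTranslate
    infer_instance
  have := abs_integral_sub_integral_le (by positivity) (hN₀ N hN) hF hb
  linarith
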